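/- Let $(N,h)$ be a connected smooth ($C^\infty$) Lorentz manifold of dimension $3$ (signature $(-,+,+)$). Assume that there is on $N$ a Lie algebra $\mathfrak n$ of (globally defined, smooth) Killing fields of $h$, under the bracket of vector fields, which is isomorphic to the $3$-dimensional Heisenberg Lie algebra $\mathfrak{heis}(3)$. The pseudo-orbit of a point $x\in N$ is the set of points which can be reached from $x$ by flowing along finitely many successive elements of $\mathfrak n$; it is a weakly embedded submanifold of $N$. Assume that all pseudo-orbits of $\mathfrak n$ have dimension at most $2$. Then: 1. every pseudo-orbit of $\mathfrak n$ is $2$-dimensional and lightlike, i.e. the restriction of $h$ to each of its tangent planes is degenerate; 2. $(N,h)$ is conformally flat: every point of $N$ has an open neighbourhood which is conformally diffeomorphic to an open subset of the Minkowski space $\mathbb R^{1,2}$. -/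

import Mathlib

open Set VectorField
open scoped Manifold ContDiff

noncomputable section

attribute [local instance] LieRing.ofAssociativeRing

/-- The Minkowski scalar product of signature `(-,+,+)` on `ℝ³`. -/
def minkowski (v w : EuclideanSpace ℝ (Fin 3)) : ℝ :=
  -(v 0 * w 0) + v 1 * w 1 + v 2 * w 2

/-- The Heisenberg Lie algebra `heis(3)`: strictly upper triangular real `3 × 3` matrices with the
commutator bracket. -/
def heis : LieSubalgebra ℝ (Matrix (Fin 3) (Fin 3) ℝ) where
  carrier := {A | ∀ i j, j ≤ i → A i j = 0}
  zero_mem' := fun _ _ _ => rfl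
  add_mem' := by
    intro A B hA hB i j hij
    simp [hA i j hij, hB i j hij]
  smul_mem' := by
    intro c A hA i j hij
    simp [hA i j hij]
  lie_mem' := by
    intro A B hA hB i j hij
    have key : ∀ C D : Matrix (Fin 3) (Fin 3) ℝ, (∀ i j, j ≤ i → C i j = 0) →
        (∀ i j, j ≤ i → D i j = 0) → (C * D) i j = 0 := by
      intro C D hC hD
      rw [Matrix.mul_apply]
      refine Finset.sum_eq_zero fun k _ => ?_
      rcases le_total k i with h | h
      · rw [hC i k h, zero_mul]
      · rw [hD k j (hij.trans h), mul_zero]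
    rw [Ring.lie_def, Matrix.sub_apply, key A B hA hB, key B A hB hA, sub_zero]

variable (N : Type*) [TopologicalSpace N] [ChartedSpace (EuclideanSpace ℝ (Fin 3)) N]
  [IsManifold (𝓡 3) ∞ N]

/-- A smooth Lorentz metric on a smooth `3`-manifold: a smooth field of bilinear forms on the
tangent spaces, each of them isometric to the Minkowski scalar product. -/
structure LorentzMetric where
  inner (x : N) : TangentSpace (𝓡 3) x →L[ℝ] TangentSpace (𝓡 3) x →L[ℝ] ℝ
  lorentzian (x : N) : ∃ ι : TangentSpace (𝓡 3) x ≃ₗ[ℝ] EuclideanSpace ℝ (Fin 3),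
    ∀ v w, inner x v w = minkowski (ι v) (ι w)
  contMDiff : ContMDiff (𝓡 3)
    ((𝓡 3).prod
      𝓘(ℝ, EuclideanSpace ℝ (Fin 3) →L[ℝ] EuclideanSpace ℝ (Fin 3) →L[ℝ] ℝ)) ∞
    (fun x ↦ Bundle.TotalSpace.mk'
      (EuclideanSpace ℝ (Fin 3) →L[ℝ] EuclideanSpace ℝ (Fin 3) →L[ℝ] ℝ)
      (E := fun x : N ↦ TangentSpace (𝓡 3) x →L[ℝ] TangentSpace (𝓡 3) x →L[ℝ] ℝ)
      x (inner x))

variable {N}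

/-- The vector field `V` is smooth on the set `U`. -/
def IsSmoothFieldOn (V : Π x : N, TangentSpace (𝓡 3) x) (U : Set N) : Prop :=
  ContMDiffOn (𝓡 3) (𝓡 3).tangent ∞ (fun x ↦ (⟨x, V x⟩ : TangentBundle (𝓡 3) N)) U

/-- The differential at `y` of a map from the manifold to a normed space `F`. -/
def differential {F : Type*} [NormedAddCommGroup F] [NormedSpace ℝ F] (φ : N → F) (y : N) :
    TangentSpace (𝓡 3) y →L[ℝ] F :=
  mfderiv (𝓡 3) 𝓘(ℝ, F) φ y

/-- `X` is a (smooth, globally defined) Killing field of `h`: the Lie derivative `L_X h` vanishes,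
that is, `X (h(V, W)) = h([X, V], W) + h(V, [X, W])` for all local smooth vector fields `V, W`. -/
def IsKilling (h : LorentzMetric N) (X : Π x : N, TangentSpace (𝓡 3) x) : Prop :=
  IsSmoothFieldOn X univ ∧
  ∀ (U : Set N) (V W : Π x : N, TangentSpace (𝓡 3) x), IsOpen U →
    IsSmoothFieldOn V U → IsSmoothFieldOn W U → ∀ x ∈ U,
      differential (fun y ↦ h.inner y (V y) (W y)) x (X x) =
        h.inner x (mlieBracket (𝓡 3) X V x) (W x) +
        h.inner x (V x) (mlieBracket (𝓡 3) X W x)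

/-- The linear space `𝔫` of vector fields is a Lie algebra of Killing fields of `h` isomorphic to
`heis(3)`. (Closure of `𝔫` under the bracket of vector fields is part of the second clause.) -/
def IsHeisKillingAlgebra (h : LorentzMetric N)
    (𝔫 : Submodule ℝ (Π x : N, TangentSpace (𝓡 3) x)) : Prop :=
  (∀ X ∈ 𝔫, IsKilling h X) ∧
  ∃ e : heis ≃ₗ[ℝ] 𝔫, ∀ A B : heis,
    (e ⁅A, B⁆ : Π x : N, TangentSpace (𝓡 3) x) =
      mlieBracket (𝓡 3) (e A : Π x : N, TangentSpace (𝓡 3) x) (e B)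

/-- The pseudo-orbit of `x`: the set of points that can be reached from `x` by flowing along
finitely many successive elements of `𝔫`. (The flows need not be complete; an integral curve on an
open interval may be followed in both directions.) -/
def pseudoOrbit (𝔫 : Submodule ℝ (Π x : N, TangentSpace (𝓡 3) x)) (x : N) : Set N :=
  {y | Relation.ReflTransGen (fun p q : N ↦ ∃ X ∈ 𝔫, ∃ (γ : ℝ → N) (a b s t : ℝ),
    s ∈ Ioo a b ∧ t ∈ Ioo a b ∧ IsMIntegralCurveOn γ X (Ioo a b) ∧ γ s = p ∧ γ t = q) x y}

/-- The tangent space at `y` to a subset `S` of the manifold: the span of the velocities at `y` of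
the `C¹` curves drawn on `S`. Pseudo-orbits are weakly embedded submanifolds, for
which these velocities are exactly the tangent vectors; so the dimension of a pseudo-orbit is the
dimension of this space at each of its points. -/
def tangentSpan (S : Set N) (y : N) : Submodule ℝ (TangentSpace (𝓡 3) y) :=
  Submodule.span ℝ {v | ∃ (γ : ℝ → N) (ε : ℝ), 0 < ε ∧
    ContMDiffOn 𝓘(ℝ, ℝ) (𝓡 3) 1 γ (Ioo (-ε) ε) ∧ (∀ t ∈ Ioo (-ε) ε, γ t ∈ S) ∧
    (⟨γ 0, mfderiv 𝓘(ℝ, ℝ) (𝓡 3) γ 0 (1 : ℝ)⟩ : TangentBundle (𝓡 3) N) = ⟨y, v⟩}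

/-- A subspace `T` of the tangent space at `y` is lightlike: the restriction of the metric to `T` is
degenerate. -/
def IsLightlike (h : LorentzMetric N) {y : N} (T : Submodule ℝ (TangentSpace (𝓡 3) y)) : Prop :=
  ∃ v ∈ T, v ≠ 0 ∧ ∀ w ∈ T, h.inner y v w = 0

/-- `h` is conformally flat: every point has an open neighbourhood (the source of the smooth chart
`φ`) which is conformally diffeomorphic to an open subset of Minkowski space. -/
def IsConformallyFlat (h : LorentzMetric N) : Prop :=
  ∀ x : N, ∃ φ ∈ IsManifold.maximalAtlas (𝓡 3) ∞ N, x ∈ φ.source ∧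
    ∃ f : N → ℝ, ContMDiffOn (𝓡 3) 𝓘(ℝ, ℝ) ∞ f φ.source ∧ ∀ y ∈ φ.source, 0 < f y ∧
      ∀ v w : TangentSpace (𝓡 3) y, h.inner y v w =
        f y * minkowski (differential φ y v) (differential φ y w)

end

/-! Write `𝔫` as the span of `X`, `Y`, `Z` with `[X, Y] = Z` central. The argument rests on three
facts.

The centre has no zero (`IsHeisenbergTriple.center_ne_zero`). On a connected manifold a Killing
field is determined by its 1-jet at a point. At a zero `p` of `Z`, a Killing field commuting with
`Z` has its value in the kernel of the linear part of `Z`; if it also vanishes at `p`, its linear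
part lies in the centralizer of that of `Z`. In `𝔰𝔬(1,2)` both are lines, which leaves no room for
three independent fields.

The orbits are lightlike (`IsHeisenbergTriple.lightlike`). Since orbits have dimension at most 2,
some nonzero `U` in `𝔫` vanishes at `p`, and `U` is not central because `Z p ≠ 0`. For generic `W`
in `𝔫`, `[U, W]` is a nonzero multiple of `Z`, and the Killing equation of `U` at its zero gives
`h([U, W], W) = 0`. So `Z p` is orthogonal to all values of `𝔫` at `p`, and these form a plane.

Conformal flatness (`exists_conformal_chart`). Near a given point take `V` in the span of `X` and
`Y`, independent of `Z` there. The fields `V` and `Z` commute, `Z` is null and orthogonal to `V`,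
and `a = h(V, V)` is positive and invariant under both. Hence `V` and `Z` are Killing for `h / a`.
The null field `T` orthogonal to `V` with `(h / a)(T, Z) = 1` is unique, so it commutes with `V` and
`Z`. The coframe dual to a commuting frame is closed, and its primitives are coordinates in which `h
/ a` is the Minkowski metric. -/

noncomputable section

/-! ### Unique continuation for Killing fields -/

section UniqueContinuation

set_option maxSynthPendingDepth 5

variable {F G : Type*} [NormedAddCommGroup F] [NormedSpace ℝ F]
  [NormedAddCommGroup G] [NormedSpace ℝ G]

/-- The Killing equation for the field `X` and the metric `g`, in coordinates. -/
def SolvesKillingOn (g : F → F →L[ℝ] F →L[ℝ] ℝ) (X : F → F) (Ω : Set F) : Prop :=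
  ∀ u ∈ Ω, ∀ v w, fderiv ℝ g u (X u) v w + g u (fderiv ℝ X u v) w + g u v (fderiv ℝ X u w) = 0

/-- Along the segment from `p` to `x` the bound becomes a linear differential inequality in one
variable, and Grönwall applies. -/
theorem eq_zero_on_ball_of_norm_fderiv_le {f : F → G} {p : F} {r K : ℝ}
    (hf : DifferentiableOn ℝ f (Metric.ball p r))
    (bound : ∀ x ∈ Metric.ball p r, ‖fderiv ℝ f x‖ ≤ K * ‖f x‖) (h0 : f p = 0) :
    ∀ x ∈ Metric.ball p r, f x = 0 := by
  intro x hx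
  have hr : 0 < r := (dist_nonneg).trans_lt hx
  set c : ℝ → F := fun t ↦ p + t • (x - p) with hc
  have hmem : ∀ t ∈ Icc (0 : ℝ) 1, c t ∈ Metric.ball p r := by
    intro t ht
    have := (convex_ball p r).add_smul_sub_mem (Metric.mem_ball_self hr) hx ht
    exact this
  have hder : ∀ t ∈ Icc (0 : ℝ) 1, HasDerivAt (fun t ↦ f (c t)) (fderiv ℝ f (c t) (x - p)) t := by
    intro t ht
    have h1 : HasDerivAt c (x - p) t := by
      simpa [hc] using ((hasDerivAt_id t).smul_const (x - p)).const_add p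
    exact ((hf.differentiableAt (Metric.isOpen_ball.mem_nhds (hmem t ht))).hasFDerivAt).comp_hasDerivAt
      t h1
  have := eq_zero_of_abs_deriv_le_mul_abs_self_of_eq_zero_right (K := K * ‖x - p‖)
    (f := fun t ↦ f (c t)) (f' := fun t ↦ fderiv ℝ f (c t) (x - p)) (a := 0) (b := 1)
    (fun t ht ↦ (hder t ht).continuousAt.continuousWithinAt)
    (fun t ht ↦ (hder t (Ico_subset_Icc_self ht)).hasDerivWithinAt) (by simpa [hc] using h0)
    (fun t ht ↦ by
      refine (ContinuousLinearMap.le_opNorm _ _).trans ?_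
      have := mul_le_mul_of_nonneg_right (bound _ (hmem t (Ico_subset_Icc_self ht)))
        (norm_nonneg (x - p))
      linarith) 1 (by simp)
  simpa [hc] using this

/-- This is the Killing equation differentiated in the direction `a`. -/
theorem SolvesKillingOn.fderiv_eq {g : F → F →L[ℝ] F →L[ℝ] ℝ} {X : F → F} {Ω : Set F}
    (hΩ : IsOpen Ω) (hg : ContDiffOn ℝ ∞ g Ω) (hX : ContDiffOn ℝ ∞ X Ω)
    (hK : SolvesKillingOn g X Ω) {u : F} (hu : u ∈ Ω) (a v w : F) :
    fderiv ℝ (fderiv ℝ g) u a (X u) v w + fderiv ℝ g u (fderiv ℝ X u a) v w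
      + fderiv ℝ g u a (fderiv ℝ X u v) w + g u (fderiv ℝ (fderiv ℝ X) u a v) w
      + fderiv ℝ g u a v (fderiv ℝ X u w) + g u v (fderiv ℝ (fderiv ℝ X) u a w) = 0 := by
  have hn := hΩ.mem_nhds hu
  have g1 := ((hg.differentiableOn (by simp)).differentiableAt hn).hasFDerivAt
  have X1 := ((hX.differentiableOn (by simp)).differentiableAt hn).hasFDerivAt
  have g2 := ((((hg.fderiv_of_isOpen hΩ (m := ∞) (by simp))).differentiableOn
    (by simp)).differentiableAt hn).hasFDerivAt
  have X2 := ((((hX.fderiv_of_isOpen hΩ (m := ∞) (by simp))).differentiableOn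
    (by simp)).differentiableAt hn).hasFDerivAt
  have e1 := ((g2.clm_apply X1).clm_apply (hasFDerivAt_const v u)).clm_apply (hasFDerivAt_const w u)
  have e2 := (g1.clm_apply (X2.clm_apply (hasFDerivAt_const v u))).clm_apply (hasFDerivAt_const w u)
  have e3 := (g1.clm_apply (hasFDerivAt_const v u)).clm_apply
    (X2.clm_apply (hasFDerivAt_const w u))
  have h0 : HasFDerivAt (fun u ↦ fderiv ℝ g u (X u) v w + g u (fderiv ℝ X u v) w
      + g u v (fderiv ℝ X u w)) (0 : F →L[ℝ] ℝ) u :=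
    (hasFDerivAt_const (0 : ℝ) u).congr_of_eventuallyEq
      (Filter.eventually_of_mem hn fun u hu ↦ hK u hu v w)
  have := DFunLike.congr_fun (((e1.add e2).add e3).unique h0) a
  simp at this
  linarith

/-- The second derivative of a Killing field is controlled by its 1-jet, by the permutation trick
that determines Christoffel symbols. The form `S a v w = g(D²X(a, v), w)` is symmetric in `a, v`,
and the differentiated Killing equation bounds its symmetrization in `v, w` by four terms linear in
the 1-jet. Twice `S a v w` is a signed sum of three such symmetrizations, whence `6 = 3 * 4 / 2`. -/
theorem SolvesKillingOn.norm_fderiv_fderiv_le {g : F → F →L[ℝ] F →L[ℝ] ℝ} {X : F → F} {Ω : Set F}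
    (hΩ : IsOpen Ω) (hg : ContDiffOn ℝ ∞ g Ω) (hX : ContDiffOn ℝ ∞ X Ω)
    (hK : SolvesKillingOn g X Ω) {u : F} (hu : u ∈ Ω) (hsymm : ∀ v w, g u v w = g u w v)
    {c M : ℝ} (hc : 0 < c) (hgc : ∀ v, c * ‖v‖ ≤ ‖g u v‖)
    (hM1 : ‖fderiv ℝ g u‖ ≤ M) (hM2 : ‖fderiv ℝ (fderiv ℝ g) u‖ ≤ M) :
    ‖fderiv ℝ (fderiv ℝ X) u‖ ≤ 6 * M / c * (‖X u‖ + ‖fderiv ℝ X u‖) := by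
  have hM : 0 ≤ M := (norm_nonneg _).trans hM1
  set J := ‖X u‖ + ‖fderiv ℝ X u‖ with hJ
  have hJ0 : 0 ≤ J := by positivity
  set S : F → F → F → ℝ := fun a v w ↦ g u (fderiv ℝ (fderiv ℝ X) u a v) w with hS
  have hXs : ∀ a v, fderiv ℝ (fderiv ℝ X) u a v = fderiv ℝ (fderiv ℝ X) u v a := fun a v ↦
    (hX.contDiffAt (hΩ.mem_nhds hu)).isSymmSndFDerivAt
      (by simpa using! WithTop.coe_le_coe.2 (le_top : (2 : ℕ∞) ≤ ⊤)) a v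
  have b1 : ∀ a v w, |fderiv ℝ (fderiv ℝ g) u a (X u) v w| ≤ M * ‖X u‖ * (‖a‖ * ‖v‖ * ‖w‖) := by
    intro a v w
    calc _ ≤ ‖fderiv ℝ (fderiv ℝ g) u‖ * ‖a‖ * ‖X u‖ * ‖v‖ * ‖w‖ := by
          rw [← Real.norm_eq_abs]
          refine (ContinuousLinearMap.le_opNorm _ _).trans ?_
          gcongr
          refine (ContinuousLinearMap.le_opNorm _ _).trans ?_
          gcongr
          refine (ContinuousLinearMap.le_opNorm _ _).trans ?_
          gcongr
          exact ContinuousLinearMap.le_opNorm _ _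
      _ ≤ M * ‖a‖ * ‖X u‖ * ‖v‖ * ‖w‖ := by gcongr
      _ = _ := by ring
  have b2 : ∀ a v w, |fderiv ℝ g u a v w| ≤ M * (‖a‖ * ‖v‖ * ‖w‖) := by
    intro a v w
    calc _ ≤ ‖fderiv ℝ g u‖ * ‖a‖ * ‖v‖ * ‖w‖ := by
          rw [← Real.norm_eq_abs]
          refine (ContinuousLinearMap.le_opNorm _ _).trans ?_
          gcongr
          refine (ContinuousLinearMap.le_opNorm _ _).trans ?_
          gcongr
          exact ContinuousLinearMap.le_opNorm _ _
      _ ≤ M * ‖a‖ * ‖v‖ * ‖w‖ := by gcongr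
      _ = _ := by ring
  have b3 : ∀ a, ‖fderiv ℝ X u a‖ ≤ ‖fderiv ℝ X u‖ * ‖a‖ := fun a ↦
    ContinuousLinearMap.le_opNorm _ _
  have key : ∀ a v w, |S a v w + S a w v| ≤ 4 * M * J * (‖a‖ * ‖v‖ * ‖w‖) := by
    intro a v w
    have h := hK.fderiv_eq hΩ hg hX hu a v w
    rw [hsymm v] at h
    have h1 := b1 a v w
    have h2 : |fderiv ℝ g u (fderiv ℝ X u a) v w| ≤ M * ‖fderiv ℝ X u‖ * (‖a‖ * ‖v‖ * ‖w‖) :=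
      (b2 _ _ _).trans (by
        calc _ ≤ M * ((‖fderiv ℝ X u‖ * ‖a‖) * ‖v‖ * ‖w‖) := by gcongr; exact b3 a
          _ = _ := by ring)
    have h3 : |fderiv ℝ g u a (fderiv ℝ X u v) w| ≤ M * ‖fderiv ℝ X u‖ * (‖a‖ * ‖v‖ * ‖w‖) :=
      (b2 _ _ _).trans (by
        calc _ ≤ M * (‖a‖ * (‖fderiv ℝ X u‖ * ‖v‖) * ‖w‖) := by gcongr; exact b3 v
          _ = _ := by ring)
    have h4 : |fderiv ℝ g u a v (fderiv ℝ X u w)| ≤ M * ‖fderiv ℝ X u‖ * (‖a‖ * ‖v‖ * ‖w‖) :=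
      (b2 _ _ _).trans (by
        calc _ ≤ M * (‖a‖ * ‖v‖ * (‖fderiv ℝ X u‖ * ‖w‖)) := by gcongr; exact b3 w
          _ = _ := by ring)
    have h5 : 0 ≤ M * ‖X u‖ * (‖a‖ * ‖v‖ * ‖w‖) := by positivity
    have h6 : 4 * M * J * (‖a‖ * ‖v‖ * ‖w‖) = 4 * (M * ‖X u‖ * (‖a‖ * ‖v‖ * ‖w‖))
      + 4 * (M * ‖fderiv ℝ X u‖ * (‖a‖ * ‖v‖ * ‖w‖)) := by rw [hJ]; ring
    have h7 : 0 ≤ M * ‖fderiv ℝ X u‖ * (‖a‖ * ‖v‖ * ‖w‖) := by positivity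
    rw [h6]
    simp only [hS]
    rw [abs_le] at h1 h2 h3 h4 ⊢
    constructor <;> linarith [h1.1, h1.2, h2.1, h2.2, h3.1, h3.2, h4.1, h4.2]
  have hSs : ∀ a v w, S a v w = S v a w := fun a v w ↦ by simp only [hS, hXs a v]
  have key2 : ∀ a v w, |S a v w| ≤ 6 * M * J * (‖a‖ * ‖v‖) * ‖w‖ := by
    intro a v w
    have h1 := key a v w
    have h2 := key v a w
    have h3 := key w a v
    have e1 := hSs v a w
    have e2 := hSs w a v
    have e3 := hSs w v a
    have : 4 * M * J * (‖v‖ * ‖a‖ * ‖w‖) = 4 * M * J * (‖a‖ * ‖v‖ * ‖w‖) := by ring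
    rw [this] at h2
    have : 4 * M * J * (‖w‖ * ‖a‖ * ‖v‖) = 4 * M * J * (‖a‖ * ‖v‖ * ‖w‖) := by ring
    rw [this] at h3
    have : 6 * M * J * (‖a‖ * ‖v‖) * ‖w‖ = 6 / 4 * (4 * M * J * (‖a‖ * ‖v‖ * ‖w‖)) := by ring
    rw [this]
    rw [abs_le] at h1 h2 h3 ⊢
    constructor <;> linarith [h1.1, h1.2, h2.1, h2.2, h3.1, h3.2]
  refine ContinuousLinearMap.opNorm_le_bound₂ _ (by positivity) fun a v ↦ ?_
  have h1 : ‖g u (fderiv ℝ (fderiv ℝ X) u a v)‖ ≤ 6 * M * J * (‖a‖ * ‖v‖) :=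
    ContinuousLinearMap.opNorm_le_bound _ (by positivity) fun w ↦ key2 a v w
  have h2 := (hgc _).trans h1
  rw [div_mul_eq_mul_div, div_mul_eq_mul_div, div_mul_eq_mul_div, le_div_iff₀ hc]
  linarith

/-- A Killing field whose `1`-jet vanishes at a point vanishes near this point. -/
theorem SolvesKillingOn.eventually_eq_zero [FiniteDimensional ℝ F]
    {g : F → F →L[ℝ] F →L[ℝ] ℝ} {X : F → F} {Ω : Set F}
    (hΩ : IsOpen Ω) (hg : ContDiffOn ℝ ∞ g Ω) (hX : ContDiffOn ℝ ∞ X Ω)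
    (hK : SolvesKillingOn g X Ω) (hsymm : ∀ u ∈ Ω, ∀ v w, g u v w = g u w v) {p : F} (hp : p ∈ Ω)
    (hnd : ∀ v, (∀ w, g p v w = 0) → v = 0) (h0 : X p = 0) (h1 : fderiv ℝ X p = 0) :
    ∀ᶠ u in nhds p, X u = 0 := by
  have hn := hΩ.mem_nhds hp
  have g1 : ContDiffOn ℝ ∞ (fderiv ℝ g) Ω := hg.fderiv_of_isOpen hΩ (by simp)
  have g2 : ContDiffOn ℝ ∞ (fderiv ℝ (fderiv ℝ g)) Ω := g1.fderiv_of_isOpen hΩ (by simp)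
  have X1 : ContDiffOn ℝ ∞ (fderiv ℝ X) Ω := hX.fderiv_of_isOpen hΩ (by simp)
  have hinj : Function.Injective (g p) := by
    rw [injective_iff_map_eq_zero]
    intro v hv
    exact hnd v fun w ↦ by rw [hv]; rfl
  obtain ⟨K, hK0, hKa⟩ := (g p).toLinearMap.exists_antilipschitzWith (LinearMap.ker_eq_bot.2 hinj)
  have hK0' : (0 : ℝ) < K := hK0
  have hanti : ∀ v, (K : ℝ)⁻¹ * ‖v‖ ≤ ‖g p v‖ := by
    intro v
    have := hKa.le_mul_dist v 0
    simp at this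
    rw [inv_mul_le_iff₀ hK0']
    exact this
  -- Half of the lower bound of `g p`: the other half absorbs the variation of `g` near `p`.
  set c : ℝ := (K : ℝ)⁻¹ / 2 with hcdef
  have hc : 0 < c := by positivity
  have ev1 : ∀ᶠ u in nhds p, ‖g u - g p‖ < c := by
    have := (hg.continuousOn.continuousAt hn).tendsto
    rw [tendsto_iff_norm_sub_tendsto_zero] at this
    exact this.eventually_lt_const hc
  set M : ℝ := max ‖fderiv ℝ g p‖ ‖fderiv ℝ (fderiv ℝ g) p‖ + 1 with hMdef
  have ev2 : ∀ᶠ u in nhds p, ‖fderiv ℝ g u‖ < M :=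
    ((g1.continuousOn.continuousAt hn).norm).eventually_lt_const
      (by have := le_max_left ‖fderiv ℝ g p‖ ‖fderiv ℝ (fderiv ℝ g) p‖; linarith)
  have ev3 : ∀ᶠ u in nhds p, ‖fderiv ℝ (fderiv ℝ g) u‖ < M :=
    ((g2.continuousOn.continuousAt hn).norm).eventually_lt_const
      (by have := le_max_right ‖fderiv ℝ g p‖ ‖fderiv ℝ (fderiv ℝ g) p‖; linarith)
  obtain ⟨r, hr, hball⟩ := Metric.eventually_nhds_iff_ball.1
    (ev1.and (ev2.and (ev3.and (hΩ.eventually_mem hp))))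
  have hM0 : 0 ≤ M := by positivity
  set J : F → F × (F →L[ℝ] F) := fun u ↦ (X u, fderiv ℝ X u) with hJ
  -- The 1-jet `J` satisfies a closed linear inequality. The factor `2` bounds the sum of the two
  -- norms by `2 * ‖J u‖`; the summand `1` covers the first component of the derivative, which is
  -- itself a component of `J`.
  have hz := eq_zero_on_ball_of_norm_fderiv_le (f := J) (p := p) (r := r)
    (K := 2 * (6 * M / c) + 1) (fun u hu ↦ by
      have hu' := hΩ.mem_nhds (hball u hu).2.2.2
      exact (((hX.differentiableOn (by simp)).differentiableAt hu').prodMk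
        ((X1.differentiableOn (by simp)).differentiableAt hu')).differentiableWithinAt)
    (fun u hu ↦ by
      obtain ⟨e1, e2, e3, huΩ⟩ := hball u hu
      have hu' := hΩ.mem_nhds huΩ
      have hgc : ∀ v, c * ‖v‖ ≤ ‖g u v‖ := by
        intro v
        have t1 := hanti v
        have t2 : ‖g p v‖ ≤ ‖g u v‖ + ‖(g u - g p) v‖ := by
          have := norm_sub_le (g u v) ((g u - g p) v)
          simpa using this
        have t3 := (g u - g p).le_opNorm v
        have t4 : ‖g u - g p‖ * ‖v‖ ≤ c * ‖v‖ := by gcongr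
        have t5 : (K : ℝ)⁻¹ = 2 * c := by rw [hcdef]; ring
        rw [t5] at t1
        linarith
      have hb := hK.norm_fderiv_fderiv_le hΩ hg hX huΩ (hsymm u huΩ) hc hgc e2.le e3.le
      have hd : fderiv ℝ J u = (fderiv ℝ X u).prod (fderiv ℝ (fderiv ℝ X) u) :=
        (((hX.differentiableOn (by simp)).differentiableAt hu').hasFDerivAt.prodMk
        ((X1.differentiableOn (by simp)).differentiableAt hu').hasFDerivAt).fderiv
      have j1 : ‖X u‖ ≤ ‖J u‖ := le_max_left _ _
      have j2 : ‖fderiv ℝ X u‖ ≤ ‖J u‖ := le_max_right _ _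
      rw [hd, ContinuousLinearMap.opNorm_prod, Prod.norm_def]
      have hq : 0 ≤ 6 * M / c := by positivity
      refine max_le ?_ ?_
      · refine j2.trans ?_
        have : 0 ≤ 2 * (6 * M / c) * ‖J u‖ := by positivity
        linarith
      · refine hb.trans ?_
        have : 6 * M / c * (‖X u‖ + ‖fderiv ℝ X u‖) ≤ 6 * M / c * (‖J u‖ + ‖J u‖) := by gcongr
        have := norm_nonneg (J u)
        linarith)
    (by simp [hJ, h0, h1])
  filter_upwards [Metric.ball_mem_nhds p hr] with u hu
  exact congrArg Prod.fst (hz u hu)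

end UniqueContinuation

/-! ### Linear algebra of Lorentz forms and of `𝔰𝔬(1,2)` -/

section LorentzAlgebra

/-- A bilinear form on `ℝ³` isometric to the Minkowski scalar product. -/
def IsLorentzForm (b : EuclideanSpace ℝ (Fin 3) →L[ℝ] EuclideanSpace ℝ (Fin 3) →L[ℝ] ℝ) : Prop :=
  ∃ ι : EuclideanSpace ℝ (Fin 3) ≃ₗ[ℝ] EuclideanSpace ℝ (Fin 3),
    ∀ v w, b v w = minkowski (ι v) (ι w)

theorem exists_skew_coordinates
    {A : EuclideanSpace ℝ (Fin 3) →ₗ[ℝ] EuclideanSpace ℝ (Fin 3)}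
    (hA : ∀ v w, minkowski (A v) w + minkowski v (A w) = 0) :
    ∃ a b c : ℝ, ∀ v, A v 0 = a * v 1 + b * v 2 ∧ A v 1 = a * v 0 + c * v 2 ∧
      A v 2 = b * v 0 - c * v 1 := by
  set e : Fin 3 → EuclideanSpace ℝ (Fin 3) := fun i ↦ EuclideanSpace.single i 1 with he
  have hv : ∀ v : EuclideanSpace ℝ (Fin 3), v = v 0 • e 0 + v 1 • e 1 + v 2 • e 2 := by
    intro v
    ext i
    fin_cases i <;> simp [he]
  have h00 := hA (e 0) (e 0)
  have h11 := hA (e 1) (e 1)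
  have h22 := hA (e 2) (e 2)
  have h01 := hA (e 0) (e 1)
  have h02 := hA (e 0) (e 2)
  have h12 := hA (e 1) (e 2)
  simp [minkowski, he] at h00 h11 h22 h01 h02 h12
  refine ⟨A (e 1) 0, A (e 2) 0, A (e 2) 1, fun v ↦ ?_⟩
  have hAv : A v = v 0 • A (e 0) + v 1 • A (e 1) + v 2 • A (e 2) := by
    conv_lhs => rw [hv v]
    simp only [map_add, map_smul]
  rw [hAv]
  simp only [PiLp.add_apply, PiLp.smul_apply, smul_eq_mul, he]
  refine ⟨?_, ?_, ?_⟩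
  · linear_combination (v 0) * h00
  · linear_combination (v 0) * h01 + (v 1) * h11
  · linear_combination (v 0) * h02 + v 1 * h12 + (v 2) * h22

theorem exists_smul_eq_of_cross_eq_zero {m u : EuclideanSpace ℝ (Fin 3)} (hm : m ≠ 0)
    (h01 : m 0 * u 1 = m 1 * u 0) (h02 : m 0 * u 2 = m 2 * u 0) (h12 : m 1 * u 2 = m 2 * u 1) :
    ∃ t : ℝ, u = t • m := by
  have : m 0 ≠ 0 ∨ m 1 ≠ 0 ∨ m 2 ≠ 0 := by
    by_contra! h
    apply hm
    ext i
    fin_cases i <;> simp [h]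
  rcases this with h | h | h
  · refine ⟨u 0 / m 0, ?_⟩
    ext i
    fin_cases i <;> simp <;> field_simp <;> linarith
  · refine ⟨u 1 / m 1, ?_⟩
    ext i
    fin_cases i <;> simp <;> field_simp <;> linarith
  · refine ⟨u 2 / m 2, ?_⟩
    ext i
    fin_cases i <;> simp <;> field_simp <;> linarith

/-- In dimension 3 a skew endomorphism is the Lorentzian cross product with a vector `m`, here `(-c,
-b, a)`. Its kernel is the line of `m`, and two such endomorphisms commute only if their vectors
have zero cross product, that is, are proportional. -/
theorem exists_axis_of_minkowski_skew
    {A : EuclideanSpace ℝ (Fin 3) →ₗ[ℝ] EuclideanSpace ℝ (Fin 3)}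
    (hA : ∀ v w, minkowski (A v) w + minkowski v (A w) = 0) (h0 : A ≠ 0) :
    ∃ m : EuclideanSpace ℝ (Fin 3), (∀ u, A u = 0 → ∃ t : ℝ, u = t • m) ∧
      ∀ B : EuclideanSpace ℝ (Fin 3) →ₗ[ℝ] EuclideanSpace ℝ (Fin 3),
        (∀ v w, minkowski (B v) w + minkowski v (B w) = 0) → (∀ v, A (B v) = B (A v)) →
        ∃ t : ℝ, B = t • A := by
  obtain ⟨a, b, c, hc⟩ := exists_skew_coordinates hA
  set m : EuclideanSpace ℝ (Fin 3) := !₂[-c, -b, a] with hm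
  have hm0 : m ≠ 0 := by
    intro h
    have h0' := congrArg (fun v : EuclideanSpace ℝ (Fin 3) ↦ v 0) h
    have h1' := congrArg (fun v : EuclideanSpace ℝ (Fin 3) ↦ v 1) h
    have h2' := congrArg (fun v : EuclideanSpace ℝ (Fin 3) ↦ v 2) h
    simp [hm] at h0' h1' h2'
    apply h0
    refine LinearMap.ext fun v ↦ ?_
    ext i
    obtain ⟨e0, e1, e2⟩ := hc v
    fin_cases i <;> simp [e0, e1, e2, h0', h1', h2']
  refine ⟨m, fun u hu ↦ ?_, fun B hB hcomm ↦ ?_⟩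
  · obtain ⟨e0, e1, e2⟩ := hc u
    simp only [hu, PiLp.zero_apply] at e0 e1 e2
    apply exists_smul_eq_of_cross_eq_zero hm0 <;> simp [hm] <;> linarith
  · obtain ⟨a', b', c', hc'⟩ := exists_skew_coordinates hB
    have q0 := hcomm (EuclideanSpace.single 0 1)
    have q1 := hcomm (EuclideanSpace.single 1 1)
    have k1 := congrArg (fun v : EuclideanSpace ℝ (Fin 3) ↦ v 1) q0
    have k2 := congrArg (fun v : EuclideanSpace ℝ (Fin 3) ↦ v 2) q0
    have k3 := congrArg (fun v : EuclideanSpace ℝ (Fin 3) ↦ v 2) q1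
    simp only [(hc _).1, (hc _).2.1, (hc _).2.2, (hc' _).1, (hc' _).2.1, (hc' _).2.2] at k1 k2 k3
    simp at k1 k2 k3
    obtain ⟨t, ht⟩ := exists_smul_eq_of_cross_eq_zero (u := !₂[-c', -b', a']) hm0
      (by simp [hm]; linarith) (by simp [hm]; linarith) (by simp [hm]; linarith)
    have h0' := congrArg (fun v : EuclideanSpace ℝ (Fin 3) ↦ v 0) ht
    have h1' := congrArg (fun v : EuclideanSpace ℝ (Fin 3) ↦ v 1) ht
    have h2' := congrArg (fun v : EuclideanSpace ℝ (Fin 3) ↦ v 2) ht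
    simp [hm] at h0' h1' h2'
    refine ⟨t, LinearMap.ext fun v ↦ ?_⟩
    ext i
    obtain ⟨e0, e1, e2⟩ := hc v
    obtain ⟨f0, f1, f2⟩ := hc' v
    fin_cases i <;> simp [e0, e1, e2, f0, f1, f2, h0', h1', h2'] <;> ring

variable {b : EuclideanSpace ℝ (Fin 3) →L[ℝ] EuclideanSpace ℝ (Fin 3) →L[ℝ] ℝ}

theorem IsLorentzForm.symm (hb : IsLorentzForm b) (v w : EuclideanSpace ℝ (Fin 3)) :
    b v w = b w v := by
  obtain ⟨ι, hι⟩ := hb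
  rw [hι, hι, minkowski, minkowski]
  ring

theorem IsLorentzForm.nondegenerate (hb : IsLorentzForm b) {v : EuclideanSpace ℝ (Fin 3)}
    (h : ∀ w, b v w = 0) : v = 0 := by
  obtain ⟨ι, hι⟩ := hb
  have h' : ∀ w, minkowski (ι v) w = 0 := fun w ↦ by
    rw [← h (ι.symm w), hι, ι.apply_symm_apply]
  have h0 := h' (EuclideanSpace.single 0 1)
  have h1 := h' (EuclideanSpace.single 1 1)
  have h2 := h' (EuclideanSpace.single 2 1)
  simp [minkowski] at h0 h1 h2
  rw [← ι.map_eq_zero_iff]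
  ext i
  fin_cases i <;> simp [h0, h1, h2]

/-- The centralizer and the kernel of a nonzero element of `𝔰𝔬(1,2)` are lines. -/
theorem IsLorentzForm.exists_axis (hb : IsLorentzForm b)
    {A : EuclideanSpace ℝ (Fin 3) →L[ℝ] EuclideanSpace ℝ (Fin 3)}
    (hA : ∀ v w, b (A v) w + b v (A w) = 0) (h0 : A ≠ 0) :
    ∃ m : EuclideanSpace ℝ (Fin 3), (∀ u, A u = 0 → ∃ t : ℝ, u = t • m) ∧
      ∀ B : EuclideanSpace ℝ (Fin 3) →L[ℝ] EuclideanSpace ℝ (Fin 3),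
        (∀ v w, b (B v) w + b v (B w) = 0) → (∀ v, A (B v) = B (A v)) →
        ∃ t : ℝ, B = t • A := by
  obtain ⟨ι, hι⟩ := hb
  have conj : ∀ B : EuclideanSpace ℝ (Fin 3) →L[ℝ] EuclideanSpace ℝ (Fin 3),
      (∀ v w, b (B v) w + b v (B w) = 0) → ∀ v w, minkowski (ι.conj B.toLinearMap v) w
        + minkowski v (ι.conj B.toLinearMap w) = 0 := by
    intro B hB v w
    have := hB (ι.symm v) (ι.symm w)
    simpa [hι, LinearEquiv.conj_apply] using this
  obtain ⟨m, hm, hm'⟩ := exists_axis_of_minkowski_skew (conj A hA) (by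
    intro h
    apply h0
    have : A.toLinearMap = 0 := ι.conj.map_eq_zero_iff.1 h
    exact ContinuousLinearMap.coe_injective this)
  refine ⟨ι.symm m, fun u hu ↦ ?_, fun B hB hcomm ↦ ?_⟩
  · obtain ⟨t, ht⟩ := hm (ι u) (by simp [LinearEquiv.conj_apply, hu])
    exact ⟨t, by rw [← map_smul, ← ht, ι.symm_apply_apply]⟩
  · obtain ⟨t, ht⟩ := hm' _ (conj B hB) (by
      intro v
      simp [LinearEquiv.conj_apply, hcomm])
    refine ⟨t, ContinuousLinearMap.coe_injective (ι.conj.injective ?_)⟩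
    rw [ht, ← map_smul]
    rfl

/-- The orthogonal of a null vector is a degenerate plane whose quotient by that vector is positive
definite. -/
theorem IsLorentzForm.pos_of_orthogonal (hb : IsLorentzForm b) {z y : EuclideanSpace ℝ (Fin 3)}
    (hz : b z z = 0) (hzy : b z y = 0) (hi : LinearIndependent ℝ ![y, z]) : 0 < b y y := by
  obtain ⟨ι, hι⟩ := hb
  rw [hι] at hz hzy ⊢
  rw [LinearIndependent.pair_iff] at hi
  have hz0 : ι z ≠ 0 := by
    intro h
    rw [ι.map_eq_zero_iff] at h
    have := hi 0 1 (by simp [h])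
    simp at this
  simp only [minkowski] at *
  set z' := ι z with hz'
  set y' := ι y with hy'
  have h0 : z' 0 ≠ 0 := by
    intro h
    rw [h] at hz
    apply hz0
    have h1 : z' 1 = 0 := by nlinarith [mul_self_nonneg (z' 1), mul_self_nonneg (z' 2)]
    have h2 : z' 2 = 0 := by nlinarith [mul_self_nonneg (z' 1), mul_self_nonneg (z' 2)]
    ext i
    fin_cases i <;> simp [h, h1, h2]
  -- Lagrange's identity in the last two coordinates, after substituting `z₀² = z₁² + z₂²` and `y₀z₀
  -- = y₁z₁ + y₂z₂`.
  have hsq : (-(y' 0 * y' 0) + y' 1 * y' 1 + y' 2 * y' 2) * (z' 0 * z' 0)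
      = (y' 1 * z' 2 - y' 2 * z' 1) ^ 2 := by
    linear_combination (-(y' 1 * y' 1 + y' 2 * y' 2)) * hz -
      (y' 0 * z' 0 + y' 1 * z' 1 + y' 2 * z' 2) * (-hzy)
  have hp : 0 < z' 0 * z' 0 := mul_self_pos.2 h0
  have hne : y' 1 * z' 2 - y' 2 * z' 1 ≠ 0 := by
    intro h
    have hy0 : z' 0 * y' 0 = z' 1 * y' 1 + z' 2 * y' 2 := by linarith
    have h01 : z' 0 * y' 1 = z' 1 * y' 0 := by
      refine mul_left_cancel₀ h0 ?_
      linear_combination (-y' 1) * hz - z' 1 * hy0 + z' 2 * h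
    have h02 : z' 0 * y' 2 = z' 2 * y' 0 := by
      refine mul_left_cancel₀ h0 ?_
      linear_combination (-y' 2) * hz - z' 2 * hy0 - z' 1 * h
    obtain ⟨t, ht⟩ := exists_smul_eq_of_cross_eq_zero hz0 h01 h02 (by linarith)
    have : y = t • z := ι.injective (by rw [map_smul]; exact ht)
    have := hi 1 (-t) (by rw [this]; simp)
    simp at this
  have : 0 < (y' 1 * z' 2 - y' 2 * z' 1) ^ 2 := by positivity
  rw [← hsq] at this
  exact (pos_iff_pos_of_mul_pos this).2 hp

end LorentzAlgebra

/-! ### Killing fields, Lie brackets and closed forms in coordinates -/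

section KillingCalculus

set_option maxSynthPendingDepth 5

variable {F H : Type*} [NormedAddCommGroup F] [NormedSpace ℝ F]
  [NormedAddCommGroup H] [NormedSpace ℝ H]

theorem fderiv_metric_apply {g : F → F →L[ℝ] F →L[ℝ] ℝ} {P Q : F → F} {u : F}
    (hg : DifferentiableAt ℝ g u) (hP : DifferentiableAt ℝ P u) (hQ : DifferentiableAt ℝ Q u)
    (v : F) :
    fderiv ℝ (fun x ↦ g x (P x) (Q x)) u v =
      fderiv ℝ g u v (P u) (Q u) + g u (fderiv ℝ P u v) (Q u) + g u (P u) (fderiv ℝ Q u v) := by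
  rw [((hg.hasFDerivAt.clm_apply hP.hasFDerivAt).clm_apply hQ.hasFDerivAt).fderiv]
  simp
  ring

/-- Along a Killing field, the derivative of the metric is given by the Lie brackets. -/
theorem SolvesKillingOn.fderiv_metric {g : F → F →L[ℝ] F →L[ℝ] ℝ} {V P Q : F → F} {Ω : Set F}
    (hK : SolvesKillingOn g V Ω) {u : F} (hu : u ∈ Ω)
    (hg : DifferentiableAt ℝ g u) (hP : DifferentiableAt ℝ P u) (hQ : DifferentiableAt ℝ Q u) :
    fderiv ℝ (fun x ↦ g x (P x) (Q x)) u (V u) =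
      g u (lieBracket ℝ V P u) (Q u) + g u (P u) (lieBracket ℝ V Q u) := by
  rw [fderiv_metric_apply hg hP hQ, lieBracket, lieBracket]
  simp only [map_sub, sub_apply]
  linarith [hK u hu (P u) (Q u)]

/-- Conformal rescaling by a function constant along `V` adds to the Killing equation only a term in
the derivative of `f` along `V`. -/
theorem SolvesKillingOn.smul {g : F → F →L[ℝ] F →L[ℝ] ℝ} {V : F → F} {Ω : Set F}
    (hK : SolvesKillingOn g V Ω) {f : F → ℝ} (hf : ∀ u ∈ Ω, DifferentiableAt ℝ f u)
    (hg : ∀ u ∈ Ω, DifferentiableAt ℝ g u) (h0 : ∀ u ∈ Ω, fderiv ℝ f u (V u) = 0) :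
    SolvesKillingOn (fun u ↦ f u • g u) V Ω := by
  intro u hu v w
  have : fderiv ℝ (fun u ↦ f u • g u) u = f u • fderiv ℝ g u + (fderiv ℝ f u).smulRight (g u) :=
    ((hf u hu).hasFDerivAt.smul (hg u hu).hasFDerivAt).fderiv
  rw [this]
  have := hK u hu v w
  simp [h0 u hu]
  linear_combination (f u) * this

/-- A `1`-form which is constant on a frame of commuting vector fields is closed. -/
theorem fderiv_symmetric_of_commuting_frame {ι : Type*} {Θ : F → F →L[ℝ] H} {V : ι → F → F} {u : F}
    (hΘ : DifferentiableAt ℝ Θ u) (hV : ∀ i, DifferentiableAt ℝ (V i) u)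
    (hc : ∀ i, ∃ c, ∀ᶠ x in nhds u, Θ x (V i x) = c)
    (hb : ∀ i j, lieBracket ℝ (V i) (V j) u = 0)
    (hs : Submodule.span ℝ (range fun i ↦ V i u) = ⊤) (v w : F) :
    fderiv ℝ Θ u v w = fderiv ℝ Θ u w v := by
  have hd : ∀ i v, fderiv ℝ Θ u v (V i u) + Θ u (fderiv ℝ (V i) u v) = 0 := by
    intro i v
    obtain ⟨c, hc⟩ := hc i
    have h1 := hΘ.hasFDerivAt.clm_apply (hV i).hasFDerivAt
    have h2 : HasFDerivAt (fun x ↦ Θ x (V i x)) (0 : F →L[ℝ] H) u :=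
      (hasFDerivAt_const c u).congr_of_eventuallyEq hc
    have := DFunLike.congr_fun (h1.unique h2) v
    simpa [add_comm] using this
  have hf : ∀ i j, fderiv ℝ Θ u (V i u) (V j u) = fderiv ℝ Θ u (V j u) (V i u) := by
    intro i j
    have h1 := hd j (V i u)
    have h2 := hd i (V j u)
    -- Differentiating `Θ(V j) = const` along `V i`, and symmetrically, leaves a difference equal to
    -- `Θ([V i, V j])` up to sign.
    have h3 := hb i j
    rw [lieBracket, sub_eq_zero] at h3
    rw [h3] at h1
    rw [← add_left_inj, h1, h2]
  have hv : v ∈ Submodule.span ℝ (range fun i ↦ V i u) := hs ▸ Submodule.mem_top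
  have hw : w ∈ Submodule.span ℝ (range fun i ↦ V i u) := hs ▸ Submodule.mem_top
  induction hv using Submodule.span_induction with
  | mem x hx =>
    obtain ⟨i, rfl⟩ := hx
    induction hw using Submodule.span_induction with
    | mem x hx =>
      obtain ⟨j, rfl⟩ := hx
      exact hf i j
    | zero => simp
    | add x y _ _ hx hy => simp [hx, hy]
    | smul a x _ hx => simp [hx]
  | zero => simp
  | add x y _ _ hx hy => simp [hx, hy]
  | smul a x _ hx => simp [hx]

end KillingCalculus

/-! ### Null frames in a Lorentz vector space -/

section NullFrame

set_option maxSynthPendingDepth 5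

variable {b : EuclideanSpace ℝ (Fin 3) →L[ℝ] EuclideanSpace ℝ (Fin 3) →L[ℝ] ℝ}
  {y z t : EuclideanSpace ℝ (Fin 3)}

theorem span_null_frame_eq_top (hs : ∀ v w, b v w = b w v) (hyy : b y y = 1) (hyz : b y z = 0)
    (hzz : b z z = 0) (hty : b t y = 0) (htz : b t z = 1) :
    Submodule.span ℝ (range ![y, z, t]) = ⊤ := by
  refine LinearIndependent.span_eq_top_of_card_eq_finrank' ?_ (by simp)
  rw [Fintype.linearIndependent_iff]
  intro c hc
  simp only [Fin.sum_univ_three, Matrix.cons_val_zero, Matrix.cons_val_one, Matrix.cons_val] at hc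
  have h1 := congrArg (b y) hc
  have h2 := congrArg (b z) hc
  have h3 := congrArg (b t) hc
  simp only [map_add, map_smul, map_zero, smul_eq_mul, hyy, hyz, hzz, hty, htz, hs y t, hs z t,
    hs z y] at h1 h2 h3
  have c0 : c 0 = 0 := by linarith
  have c2 : c 2 = 0 := by linarith
  have c1 : c 1 = 0 := by rw [c2] at h3; linarith
  intro i
  fin_cases i
  exacts [c0, c1, c2]

theorem eq_zero_of_orthogonal_null_frame (hs : ∀ v w, b v w = b w v) (hyy : b y y = 1)
    (hyz : b y z = 0) (hzz : b z z = 0) (hty : b t y = 0) (htz : b t z = 1)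
    (hnd : ∀ v, (∀ w, b v w = 0) → v = 0) {v : EuclideanSpace ℝ (Fin 3)}
    (h1 : b v y = 0) (h2 : b v z = 0) (h3 : b v t = 0) : v = 0 := by
  refine hnd v fun w ↦ ?_
  have hw : w ∈ Submodule.span ℝ (range ![y, z, t]) :=
    span_null_frame_eq_top hs hyy hyz hzz hty htz ▸ Submodule.mem_top
  induction hw using Submodule.span_induction with
  | mem x hx =>
    obtain ⟨i, rfl⟩ := hx
    fin_cases i
    exacts [h1, h2, h3]
  | zero => simp
  | add x y _ _ hx hy => simp [hx, hy]
  | smul a x _ hx => simp [hx]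

/-- The basis dual to `y, z, t` is `b y, b t, b z`: the null vectors `z` and `t` are exchanged. -/
theorem null_frame_decomposition (hs : ∀ v w, b v w = b w v) (hyy : b y y = 1)
    (hyz : b y z = 0) (hzz : b z z = 0) (hty : b t y = 0) (htz : b t z = 1) (htt : b t t = 0)
    (hnd : ∀ v, (∀ w, b v w = 0) → v = 0) (v w : EuclideanSpace ℝ (Fin 3)) :
    b v w = b y v * b y w + b t v * b z w + b z v * b t w := by
  have h : v - (b y v • y + b t v • z + b z v • t) = 0 := by
    apply eq_zero_of_orthogonal_null_frame hs hyy hyz hzz hty htz hnd <;>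
    simp only [map_sub, map_add, map_smul, sub_apply,
      add_apply, smul_apply, smul_eq_mul, hyy, hyz, hzz,
      hty, htz, htt, hs y t, hs z t, hs z y, hs v y, hs v z, hs v t] <;> ring
  conv_lhs => rw [sub_eq_zero.1 h]
  simp

/-- The coframe of Minkowski coordinates dual to a null frame. -/
def nullCoframe (b : EuclideanSpace ℝ (Fin 3) →L[ℝ] EuclideanSpace ℝ (Fin 3) →L[ℝ] ℝ)
    (y z t : EuclideanSpace ℝ (Fin 3)) : EuclideanSpace ℝ (Fin 3) →L[ℝ] EuclideanSpace ℝ (Fin 3) :=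
  (b y).smulRight !₂[0, 0, 1] + (b t).smulRight !₂[1, 1, 0] + (b z).smulRight !₂[-1 / 2, 1 / 2, 0]

/-- The coframe sends `y, z, t` to `(0,0,1), (1,1,0), (-1/2,1/2,0)`, vectors with the same mutual
products for the Minkowski form. -/
theorem minkowski_nullCoframe (hs : ∀ v w, b v w = b w v) (hyy : b y y = 1)
    (hyz : b y z = 0) (hzz : b z z = 0) (hty : b t y = 0) (htz : b t z = 1) (htt : b t t = 0)
    (hnd : ∀ v, (∀ w, b v w = 0) → v = 0) (v w : EuclideanSpace ℝ (Fin 3)) :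
    minkowski (nullCoframe b y z t v) (nullCoframe b y z t w) = b v w := by
  rw [null_frame_decomposition hs hyy hyz hzz hty htz htt hnd v w]
  simp [minkowski, nullCoframe]
  ring

end NullFrame

/-! ### Flat and conformally flat charts from commuting Killing fields -/

section FlatChart

set_option maxSynthPendingDepth 5

variable {g : EuclideanSpace ℝ (Fin 3) → EuclideanSpace ℝ (Fin 3) →L[ℝ]
    EuclideanSpace ℝ (Fin 3) →L[ℝ] ℝ}
  {Y Z T : EuclideanSpace ℝ (Fin 3) → EuclideanSpace ℝ (Fin 3)}
  {Ω : Set (EuclideanSpace ℝ (Fin 3))}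

/-- The fields `Y, Z, T` form a null frame of the metric `g` on `Ω`. -/
structure IsNullFrameOn (g : EuclideanSpace ℝ (Fin 3) → EuclideanSpace ℝ (Fin 3) →L[ℝ]
    EuclideanSpace ℝ (Fin 3) →L[ℝ] ℝ)
    (Y Z T : EuclideanSpace ℝ (Fin 3) → EuclideanSpace ℝ (Fin 3))
    (Ω : Set (EuclideanSpace ℝ (Fin 3))) : Prop where
  smooth : ContDiffOn ℝ ∞ g Ω
  smooth_y : ContDiffOn ℝ ∞ Y Ω
  smooth_z : ContDiffOn ℝ ∞ Z Ω
  smooth_t : ContDiffOn ℝ ∞ T Ω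
  symm : ∀ u ∈ Ω, ∀ v w, g u v w = g u w v
  nondegenerate : ∀ u ∈ Ω, ∀ v, (∀ w, g u v w = 0) → v = 0
  yy : ∀ u ∈ Ω, g u (Y u) (Y u) = 1
  yz : ∀ u ∈ Ω, g u (Y u) (Z u) = 0
  zz : ∀ u ∈ Ω, g u (Z u) (Z u) = 0
  ty : ∀ u ∈ Ω, g u (T u) (Y u) = 0
  tz : ∀ u ∈ Ω, g u (T u) (Z u) = 1
  tt : ∀ u ∈ Ω, g u (T u) (T u) = 0

theorem fderiv_eq_zero_of_eqOn_const {F H : Type*} [NormedAddCommGroup F] [NormedSpace ℝ F]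
    [NormedAddCommGroup H] [NormedSpace ℝ H] {f : F → H} {s : Set F} (hs : IsOpen s) {c : H}
    (hf : ∀ x ∈ s, f x = c) {u : F} (hu : u ∈ s) : fderiv ℝ f u = 0 := by
  have : f =ᶠ[nhds u] fun _ ↦ c := Filter.eventually_of_mem (hs.mem_nhds hu) hf
  rw [this.fderiv_eq]
  simp

/-- The field `T` is determined by `g`, `Y`, `Z` through constant scalar products, so a symmetry
preserving `g`, `Y`, `Z` preserves it. Concretely, differentiating these products along `V` makes
`[V, T]` orthogonal to the whole frame. -/
theorem IsNullFrameOn.lieBracket_eq_zero (h : IsNullFrameOn g Y Z T Ω) (hΩ : IsOpen Ω)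
    {V : EuclideanSpace ℝ (Fin 3) → EuclideanSpace ℝ (Fin 3)} (hV : SolvesKillingOn g V Ω)
    {u : EuclideanSpace ℝ (Fin 3)} (hu : u ∈ Ω) (hVY : lieBracket ℝ V Y u = 0)
    (hVZ : lieBracket ℝ V Z u = 0) : lieBracket ℝ V T u = 0 := by
  have hn := hΩ.mem_nhds hu
  have dg := (h.smooth.differentiableOn (by simp)).differentiableAt hn
  have dY := (h.smooth_y.differentiableOn (by simp)).differentiableAt hn
  have dZ := (h.smooth_z.differentiableOn (by simp)).differentiableAt hn
  have dT := (h.smooth_t.differentiableOn (by simp)).differentiableAt hn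
  have e1 := hV.fderiv_metric hu dg dT dY
  have e2 := hV.fderiv_metric hu dg dT dZ
  have e3 := hV.fderiv_metric hu dg dT dT
  rw [fderiv_eq_zero_of_eqOn_const hΩ h.ty hu, hVY] at e1
  rw [fderiv_eq_zero_of_eqOn_const hΩ h.tz hu, hVZ] at e2
  rw [fderiv_eq_zero_of_eqOn_const hΩ h.tt hu, h.symm u hu (T u)] at e3
  simp only [zero_apply, map_zero, add_zero] at e1 e2 e3
  exact eq_zero_of_orthogonal_null_frame (h.symm u hu) (h.yy u hu) (h.yz u hu) (h.zz u hu)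
    (h.ty u hu) (h.tz u hu) (h.nondegenerate u hu) e1.symm e2.symm (by linarith)

/-- A metric with a commuting null frame is flat. -/
theorem IsNullFrameOn.exists_chart (h : IsNullFrameOn g Y Z T Ω) (hΩ : IsOpen Ω)
    (hconv : Convex ℝ Ω) (hYZ : ∀ u ∈ Ω, lieBracket ℝ Y Z u = 0)
    (hYT : ∀ u ∈ Ω, lieBracket ℝ Y T u = 0) (hZT : ∀ u ∈ Ω, lieBracket ℝ Z T u = 0)
    {p : EuclideanSpace ℝ (Fin 3)} (hp : p ∈ Ω) :
    ∃ ψ : OpenPartialHomeomorph (EuclideanSpace ℝ (Fin 3)) (EuclideanSpace ℝ (Fin 3)),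
      p ∈ ψ.source ∧ ψ.source ⊆ Ω ∧ ContDiffOn ℝ ∞ ψ ψ.source ∧
      ContDiffOn ℝ ∞ ψ.symm ψ.target ∧ ∀ u ∈ ψ.source, ∀ v w,
        minkowski (fderiv ℝ ψ u v) (fderiv ℝ ψ u w) = g u v w := by
  set Θ : EuclideanSpace ℝ (Fin 3) → EuclideanSpace ℝ (Fin 3) →L[ℝ] EuclideanSpace ℝ (Fin 3) :=
    fun u ↦ nullCoframe (g u) (Y u) (Z u) (T u) with hΘdef
  have hmin : ∀ u ∈ Ω, ∀ v w, minkowski (Θ u v) (Θ u w) = g u v w := fun u hu v w ↦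
    minkowski_nullCoframe (h.symm u hu) (h.yy u hu) (h.yz u hu) (h.zz u hu) (h.ty u hu) (h.tz u hu)
      (h.tt u hu) (h.nondegenerate u hu) v w
  have hΘ : ContDiffOn ℝ ∞ Θ Ω :=
    (((h.smooth.clm_apply h.smooth_y).smulRight contDiffOn_const).add
      ((h.smooth.clm_apply h.smooth_t).smulRight contDiffOn_const)).add
      ((h.smooth.clm_apply h.smooth_z).smulRight contDiffOn_const)
  -- `Θ` takes constant values on the commuting frame `Y, Z, T`, hence is closed.
  have hsymm : ∀ u ∈ Ω, ∀ v w, fderiv ℝ Θ u v w = fderiv ℝ Θ u w v := by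
    intro u hu
    have hn := hΩ.mem_nhds hu
    have s01 := hYZ u hu
    have s02 := hYT u hu
    have s12 := hZT u hu
    have s10 : lieBracket ℝ Z Y u = 0 := by rw [lieBracket_swap, s01, neg_zero]
    have s20 : lieBracket ℝ T Y u = 0 := by rw [lieBracket_swap, s02, neg_zero]
    have s21 : lieBracket ℝ T Z u = 0 := by rw [lieBracket_swap, s12, neg_zero]
    refine fderiv_symmetric_of_commuting_frame (V := ![Y, Z, T])
      ((hΘ.differentiableOn (by simp)).differentiableAt hn) ?_ ?_ ?_ ?_
    · intro i
      fin_cases i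
      · exact (h.smooth_y.differentiableOn (by simp)).differentiableAt hn
      · exact (h.smooth_z.differentiableOn (by simp)).differentiableAt hn
      · exact (h.smooth_t.differentiableOn (by simp)).differentiableAt hn
    · intro i
      fin_cases i
      · refine ⟨!₂[0, 0, 1], Filter.eventually_of_mem hn fun x hx ↦ ?_⟩
        simp [hΘdef, nullCoframe, h.yy x hx, h.ty x hx, h.symm x hx (Z x), h.yz x hx]
      · refine ⟨!₂[1, 1, 0], Filter.eventually_of_mem hn fun x hx ↦ ?_⟩
        simp [hΘdef, nullCoframe, h.zz x hx, h.tz x hx, h.yz x hx]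
      · refine ⟨!₂[-1 / 2, 1 / 2, 0], Filter.eventually_of_mem hn fun x hx ↦ ?_⟩
        simp [hΘdef, nullCoframe, h.symm x hx _ (T x), h.tt x hx, h.tz x hx, h.ty x hx]
    · intro i j
      fin_cases i <;> fin_cases j <;>
        simp [lieBracket_self, s01, s02, s12, s10, s20, s21]
    · have := span_null_frame_eq_top (h.symm u hu) (h.yy u hu) (h.yz u hu) (h.zz u hu) (h.ty u hu)
        (h.tz u hu)
      rw [← this]
      congr 2
      funext i
      fin_cases i <;> rfl
  -- Poincaré lemma on the convex set `Ω`. The primitive `φ` has the pointwise isometry `Θ` as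
  -- differential, so the inverse function theorem makes it a chart.
  obtain ⟨φ, hφ⟩ := hconv.exists_forall_hasFDerivAt_of_fderiv_symmetric hΩ
    (hΘ.differentiableOn (by simp)) hsymm
  have hφs : ContDiffOn ℝ ∞ φ Ω := by
    rw [contDiffOn_infty_iff_fderiv_of_isOpen hΩ]
    exact ⟨fun u hu ↦ (hφ u hu).differentiableAt.differentiableWithinAt,
      hΘ.congr fun u hu ↦ (hφ u hu).fderiv⟩
  have hequiv : ∀ u ∈ Ω, ∃ L : EuclideanSpace ℝ (Fin 3) ≃L[ℝ] EuclideanSpace ℝ (Fin 3),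
      (L : EuclideanSpace ℝ (Fin 3) →L[ℝ] EuclideanSpace ℝ (Fin 3)) = Θ u := by
    intro u hu
    have hinj : Function.Injective (Θ u).toLinearMap := by
      rw [injective_iff_map_eq_zero]
      intro v hv
      refine h.nondegenerate u hu v fun w ↦ ?_
      have hv' : Θ u v = 0 := hv
      rw [← hmin u hu, hv']
      simp [minkowski]
    refine ⟨(LinearEquiv.ofInjectiveEndo _ hinj).toContinuousLinearEquiv, ?_⟩
    ext v
    rfl
  obtain ⟨L, hL⟩ := hequiv p hp
  have hcd : ContDiffAt ℝ ∞ φ p := hφs.contDiffAt (hΩ.mem_nhds hp)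
  have hfd : HasFDerivAt φ (L : EuclideanSpace ℝ (Fin 3) →L[ℝ] EuclideanSpace ℝ (Fin 3)) p :=
    hL ▸ hφ p hp
  set ψ := (hcd.toOpenPartialHomeomorph φ hfd (by simp)).restrOpen Ω hΩ with hψ
  have hψφ : (ψ : EuclideanSpace ℝ (Fin 3) → EuclideanSpace ℝ (Fin 3)) = φ := rfl
  have hsub : ψ.source ⊆ Ω := fun u hu ↦ hu.2
  refine ⟨ψ, ⟨hcd.mem_toOpenPartialHomeomorph_source hfd (by simp), hp⟩, hsub,
    hψφ ▸ hφs.mono hsub, ?_, ?_⟩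
  · intro y hy
    have hy' : ψ.symm y ∈ Ω := hsub (ψ.map_target hy)
    obtain ⟨L', hL'⟩ := hequiv _ hy'
    exact (ψ.contDiffAt_symm hy (hL' ▸ hφ _ hy')
      (hφs.contDiffAt (hΩ.mem_nhds hy'))).contDiffWithinAt
  · intro u hu v w
    rw [hψφ, (hφ u (hsub hu)).fderiv]
    exact hmin u (hsub hu) v w

/-- A Lorentz metric on an open subset of `ℝ³` with two commuting Killing fields spanning lightlike
planes is conformally flat. -/
theorem exists_conformal_chart (hΩ : IsOpen Ω) (hg : ContDiffOn ℝ ∞ g Ω)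
    (hl : ∀ u ∈ Ω, IsLorentzForm (g u)) (hY : ContDiffOn ℝ ∞ Y Ω) (hZ : ContDiffOn ℝ ∞ Z Ω)
    (kY : SolvesKillingOn g Y Ω) (kZ : SolvesKillingOn g Z Ω)
    (hYZ : ∀ u ∈ Ω, lieBracket ℝ Y Z u = 0) (hzz : ∀ u ∈ Ω, g u (Z u) (Z u) = 0)
    (hzy : ∀ u ∈ Ω, g u (Z u) (Y u) = 0) {p : EuclideanSpace ℝ (Fin 3)} (hp : p ∈ Ω)
    (hi : LinearIndependent ℝ ![Y p, Z p]) :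
    ∃ ψ : OpenPartialHomeomorph (EuclideanSpace ℝ (Fin 3)) (EuclideanSpace ℝ (Fin 3)),
      p ∈ ψ.source ∧ ψ.source ⊆ Ω ∧ ContDiffOn ℝ ∞ ψ ψ.source ∧
      ContDiffOn ℝ ∞ ψ.symm ψ.target ∧ ∃ f : EuclideanSpace ℝ (Fin 3) → ℝ,
        ContDiffOn ℝ ∞ f ψ.source ∧ ∀ u ∈ ψ.source, 0 < f u ∧ ∀ v w,
        g u v w = f u * minkowski (fderiv ℝ ψ u v) (fderiv ℝ ψ u w) := by
  -- The conformal factor. It is positive at `p` because `Y p` is orthogonal to the null vector `Z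
  -- p` and independent of it; it is invariant under `Y` and `Z` because they are Killing and
  -- commute.
  set a : EuclideanSpace ℝ (Fin 3) → ℝ := fun u ↦ g u (Y u) (Y u) with ha
  have has : ContDiffOn ℝ ∞ a Ω := (hg.clm_apply hY).clm_apply hY
  have hap : 0 < a p := (hl p hp).pos_of_orthogonal (hzz p hp) (hzy p hp) hi
  have hZp : Z p ≠ 0 := by
    intro h0
    rw [LinearIndependent.pair_iff] at hi
    have := hi 0 1 (by simp [h0])
    simp at this
  obtain ⟨v₀, hv₀⟩ : ∃ v₀, g p v₀ (Z p) ≠ 0 := by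
    by_contra! h0
    exact hZp ((hl p hp).nondegenerate fun w ↦ by rw [(hl p hp).symm, h0])
  have hc : ContDiffOn ℝ ∞ (fun u ↦ g u v₀ (Z u)) Ω :=
    (hg.clm_apply contDiffOn_const).clm_apply hZ
  have hn := hΩ.mem_nhds hp
  obtain ⟨r, hr, hball⟩ := Metric.eventually_nhds_iff_ball.1
    (((has.continuousOn.continuousAt hn).eventually_const_lt hap).and
    (((hc.continuousOn.continuousAt hn).eventually_ne hv₀).and (hΩ.eventually_mem hp)))
  set B := Metric.ball p r with hB
  have hBo : IsOpen B := Metric.isOpen_ball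
  have hBΩ : B ⊆ Ω := fun u hu ↦ (hball u hu).2.2
  have hgd : ∀ u ∈ B, DifferentiableAt ℝ g u := fun u hu ↦
    (hg.differentiableOn (by simp)).differentiableAt (hΩ.mem_nhds (hBΩ hu))
  have hYd : ∀ u ∈ B, DifferentiableAt ℝ Y u := fun u hu ↦
    (hY.differentiableOn (by simp)).differentiableAt (hΩ.mem_nhds (hBΩ hu))
  have had : ∀ u ∈ B, DifferentiableAt ℝ a u := fun u hu ↦
    (has.differentiableOn (by simp)).differentiableAt (hΩ.mem_nhds (hBΩ hu))
  have ha0 : ∀ u ∈ B, a u ≠ 0 := fun u hu ↦ (hball u hu).1.ne'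
  have haY : ∀ u ∈ B, fderiv ℝ a u (Y u) = 0 := by
    intro u hu
    rw [kY.fderiv_metric (hBΩ hu) (hgd u hu) (hYd u hu) (hYd u hu)]
    simp
  have haZ : ∀ u ∈ B, fderiv ℝ a u (Z u) = 0 := by
    intro u hu
    rw [kZ.fderiv_metric (hBΩ hu) (hgd u hu) (hYd u hu) (hYd u hu), lieBracket_swap,
      hYZ u (hBΩ hu)]
    simp
  set G := fun u ↦ (a u)⁻¹ • g u with hG
  have hinv : ∀ u ∈ B, HasFDerivAt (fun u ↦ (a u)⁻¹) (-(a u ^ 2)⁻¹ • fderiv ℝ a u) u :=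
    fun u hu ↦ (hasDerivAt_inv (ha0 u hu)).comp_hasFDerivAt u (had u hu).hasFDerivAt
  have kYG : SolvesKillingOn G Y B :=
    SolvesKillingOn.smul (fun u hu ↦ kY u (hBΩ hu)) (fun u hu ↦ (hinv u hu).differentiableAt) hgd
      fun u hu ↦ by rw [(hinv u hu).fderiv]; simp [haY u hu]
  have kZG : SolvesKillingOn G Z B :=
    SolvesKillingOn.smul (fun u hu ↦ kZ u (hBΩ hu)) (fun u hu ↦ (hinv u hu).differentiableAt) hgd
      fun u hu ↦ by rw [(hinv u hu).fderiv]; simp [haZ u hu]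
  have hGs : ContDiffOn ℝ ∞ G B := ((has.mono hBΩ).inv ha0).smul (hg.mono hBΩ)
  have hY' := hY.mono hBΩ
  have hZ' := hZ.mono hBΩ
  -- Gram–Schmidt for a null frame: `T₁` has product 1 with `Z`, `T₂` is also orthogonal to `Y`, and
  -- subtracting a multiple of `Z` makes `T` null without changing the other two products.
  set T₁ := fun u ↦ (G u v₀ (Z u))⁻¹ • v₀ with hT₁
  set T₂ := fun u ↦ T₁ u - G u (T₁ u) (Y u) • Y u with hT₂
  set T := fun u ↦ T₂ u - (G u (T₂ u) (T₂ u) / 2) • Z u with hT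
  have hGv : ∀ u ∈ B, G u v₀ (Z u) ≠ 0 := by
    intro u hu
    simpa [hG] using ⟨ha0 u hu, (hball u hu).2.1⟩
  have hT₁s : ContDiffOn ℝ ∞ T₁ B :=
    (((hGs.clm_apply contDiffOn_const).clm_apply hZ').inv hGv).smul contDiffOn_const
  have hT₂s : ContDiffOn ℝ ∞ T₂ B :=
    hT₁s.sub (((hGs.clm_apply hT₁s).clm_apply hY').smul hY')
  have hTs : ContDiffOn ℝ ∞ T B :=
    hT₂s.sub ((((hGs.clm_apply hT₂s).clm_apply hT₂s).div_const 2).smul hZ')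
  have Gs : ∀ u ∈ B, ∀ v w, G u v w = G u w v := fun u hu v w ↦ by
    simp [hG, (hl u (hBΩ hu)).symm v w]
  have Gyy : ∀ u ∈ B, G u (Y u) (Y u) = 1 := fun u hu ↦ by
    simpa [hG] using inv_mul_cancel₀ (ha0 u hu)
  have Gzy : ∀ u ∈ B, G u (Z u) (Y u) = 0 := fun u hu ↦ by simp [hG, hzy u (hBΩ hu)]
  have Gyz : ∀ u ∈ B, G u (Y u) (Z u) = 0 := fun u hu ↦ by rw [Gs u hu, Gzy u hu]
  have Gzz : ∀ u ∈ B, G u (Z u) (Z u) = 0 := fun u hu ↦ by simp [hG, hzz u (hBΩ hu)]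
  have G1z : ∀ u ∈ B, G u (T₁ u) (Z u) = 1 := fun u hu ↦ by
    simpa only [hT₁, map_smul, smul_apply, smul_eq_mul] using inv_mul_cancel₀ (hGv u hu)
  have G2z : ∀ u ∈ B, G u (T₂ u) (Z u) = 1 := fun u hu ↦ by
    simp only [hT₂, map_sub, map_smul, sub_apply, smul_apply, smul_eq_mul, G1z u hu, Gyz u hu]
    ring
  have G2y : ∀ u ∈ B, G u (T₂ u) (Y u) = 0 := fun u hu ↦ by
    simp only [hT₂, map_sub, map_smul, sub_apply, smul_apply, smul_eq_mul, Gyy u hu]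
    ring
  have hframe : IsNullFrameOn G Y Z T B :=
    { smooth := hGs
      smooth_y := hY'
      smooth_z := hZ'
      smooth_t := hTs
      symm := Gs
      nondegenerate := fun u hu v hv ↦ (hl u (hBΩ hu)).nondegenerate fun w ↦ by
        simpa [hG, ha0 u hu] using hv w
      yy := Gyy
      yz := Gyz
      zz := Gzz
      ty := fun u hu ↦ by
        simp only [hT, map_sub, map_smul, sub_apply, smul_apply, smul_eq_mul, G2y u hu, Gzy u hu]
        ring
      tz := fun u hu ↦ by
        simp only [hT, map_sub, map_smul, sub_apply, smul_apply, smul_eq_mul, G2z u hu, Gzz u hu]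
        ring
      tt := fun u hu ↦ by
        simp only [hT, map_sub, map_smul, sub_apply, smul_apply, smul_eq_mul, G2z u hu, Gzz u hu,
          Gs u hu (Z u) (T₂ u)]
        ring }
  obtain ⟨ψ, hpψ, hψB, hψ, hψs, hmin⟩ := hframe.exists_chart hBo (convex_ball p r)
    (fun u hu ↦ hYZ u (hBΩ hu))
    (fun u hu ↦ hframe.lieBracket_eq_zero hBo kYG hu (by simp) (hYZ u (hBΩ hu)))
    (fun u hu ↦ hframe.lieBracket_eq_zero hBo kZG hu
      (by rw [lieBracket_swap, hYZ u (hBΩ hu), neg_zero]) (by simp))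
    (Metric.mem_ball_self hr)
  refine ⟨ψ, hpψ, hψB.trans hBΩ, hψ, hψs, a, has.mono (hψB.trans hBΩ), fun u hu ↦
    ⟨(hball u (hψB hu)).1, fun v w ↦ ?_⟩⟩
  rw [hmin u hu]
  have := ha0 u (hψB hu)
  simp only [hG, smul_apply, smul_eq_mul]
  field_simp

end FlatChart

local notation "ℝ³" => EuclideanSpace ℝ (Fin 3)

/-! ### Vector fields and metrics read in charts -/

section ChartTransport

variable {N : Type*} [TopologicalSpace N] [ChartedSpace (EuclideanSpace ℝ (Fin 3)) N]

/-- The expression of a vector field in the chart at `x₀`. -/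
def chartField (x₀ : N) (V : Π x : N, TangentSpace (𝓡 3) x) :
    EuclideanSpace ℝ (Fin 3) → EuclideanSpace ℝ (Fin 3) :=
  mpullback 𝓘(ℝ, EuclideanSpace ℝ (Fin 3)) (𝓡 3) (chartAt (EuclideanSpace ℝ (Fin 3)) x₀).symm V

/-- The vector field with constant expression `v` in the chart at `x₀`. -/
def chartConst (x₀ : N) (v : EuclideanSpace ℝ (Fin 3)) : Π x : N, TangentSpace (𝓡 3) x :=
  mpullback (𝓡 3) 𝓘(ℝ, EuclideanSpace ℝ (Fin 3)) (chartAt (EuclideanSpace ℝ (Fin 3)) x₀)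
    (fun _ ↦ v)

/-- The differential of the inverse of the chart at `x₀`. -/
def chartSymmDeriv (x₀ : N) (u : EuclideanSpace ℝ (Fin 3)) : EuclideanSpace ℝ (Fin 3) →L[ℝ]
    TangentSpace (𝓡 3) ((chartAt (EuclideanSpace ℝ (Fin 3)) x₀).symm u) :=
  mfderiv 𝓘(ℝ, EuclideanSpace ℝ (Fin 3)) (𝓡 3) (chartAt (EuclideanSpace ℝ (Fin 3)) x₀).symm u

/-- The differential of the chart at `x₀`. -/
def chartDeriv (x₀ : N) (x : N) : TangentSpace (𝓡 3) x →L[ℝ] EuclideanSpace ℝ (Fin 3) :=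
  mfderiv (𝓡 3) 𝓘(ℝ, EuclideanSpace ℝ (Fin 3)) (chartAt (EuclideanSpace ℝ (Fin 3)) x₀) x

theorem chartField_add_smul (x₀ : N) (V W : Π x : N, TangentSpace (𝓡 3) x) (a b : ℝ) :
    chartField x₀ (a • V + b • W) = a • chartField x₀ V + b • chartField x₀ W := by
  rw [chartField, mpullback_add, mpullback_const_smul, mpullback_const_smul]
  rfl

variable [IsManifold (𝓡 3) ∞ N]

theorem chart_mdifferentiable (x₀ : N) :
    (chartAt ℝ³ x₀).MDifferentiable (𝓡 3) 𝓘(ℝ, ℝ³) :=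
  have : IsManifold (𝓡 3) 1 N := .of_le (n := ∞) (by simp)
  mdifferentiable_chart x₀

theorem chartDeriv_chartSymmDeriv (x₀ : N) {u : ℝ³} (hu : u ∈ (chartAt ℝ³ x₀).target) (v : ℝ³) :
    chartDeriv x₀ _ (chartSymmDeriv x₀ u v) = v :=
  DFunLike.congr_fun ((chart_mdifferentiable x₀).comp_symm_deriv hu) v

theorem chartSymmDeriv_chartDeriv (x₀ : N) {u : ℝ³} (hu : u ∈ (chartAt ℝ³ x₀).target)
    (v : TangentSpace (𝓡 3) ((chartAt ℝ³ x₀).symm u)) :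
    chartSymmDeriv x₀ u (chartDeriv x₀ _ v) = v := by
  have := (chart_mdifferentiable x₀).symm_comp_deriv ((chartAt ℝ³ x₀).map_target hu)
  rw [(chartAt ℝ³ x₀).right_inv hu] at this
  exact DFunLike.congr_fun this v

theorem chartSymmDeriv_isInvertible (x₀ : N) {u : ℝ³} (hu : u ∈ (chartAt ℝ³ x₀).target) :
    (mfderiv 𝓘(ℝ, ℝ³) (𝓡 3) (chartAt ℝ³ x₀).symm u).IsInvertible :=
  ContinuousLinearMap.IsInvertible.of_inverse (g := chartDeriv x₀ _)
    (ContinuousLinearMap.ext fun v ↦ chartSymmDeriv_chartDeriv x₀ hu v)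
    (ContinuousLinearMap.ext fun v ↦ chartDeriv_chartSymmDeriv x₀ hu v)

theorem chartSymmDeriv_chartField (x₀ : N) (V : Π x : N, TangentSpace (𝓡 3) x) {u : ℝ³}
    (hu : u ∈ (chartAt ℝ³ x₀).target) :
    chartSymmDeriv x₀ u (chartField x₀ V u) = V ((chartAt ℝ³ x₀).symm u) :=
  (chartSymmDeriv_isInvertible x₀ hu).self_apply_inverse _

theorem chartField_eq (x₀ : N) (V : Π x : N, TangentSpace (𝓡 3) x) {u : ℝ³}
    (hu : u ∈ (chartAt ℝ³ x₀).target) :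
    chartField x₀ V u = chartDeriv x₀ _ (V ((chartAt ℝ³ x₀).symm u)) := by
  rw [← chartSymmDeriv_chartField x₀ V hu, chartDeriv_chartSymmDeriv x₀ hu]

theorem chartDeriv_isInvertible (x₀ : N) {x : N} (hx : x ∈ (chartAt ℝ³ x₀).source) :
    (mfderiv (𝓡 3) 𝓘(ℝ, ℝ³) (chartAt ℝ³ x₀) x).IsInvertible :=
  ⟨(chart_mdifferentiable x₀).mfderiv hx, rfl⟩

theorem chartField_chartConst (x₀ : N) (v : ℝ³) {u : ℝ³} (hu : u ∈ (chartAt ℝ³ x₀).target) :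
    chartField x₀ (chartConst x₀ v) u = v := by
  rw [chartField_eq x₀ _ hu]
  exact (chartDeriv_isInvertible x₀ ((chartAt ℝ³ x₀).map_target hu)).self_apply_inverse _

theorem isSmoothFieldOn_chartConst (x₀ : N) (v : ℝ³) :
    IsSmoothFieldOn (chartConst x₀ v) (chartAt ℝ³ x₀).source := by
  intro x hx
  refine ContMDiffAt.contMDiffWithinAt (ContMDiffAt.mpullback_vectorField_preimage (n := ∞) ?_ ?_
    (chartDeriv_isInvertible x₀ hx) (by simp))
  · exact contMDiffAt_vectorSpace_iff_contDiffAt.2 contDiffAt_const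
  · exact contMDiffAt_of_mem_maximalAtlas (IsManifold.chart_mem_maximalAtlas x₀) hx

theorem contMDiffAt_chart_symm (x₀ : N) {u : ℝ³} (hu : u ∈ (chartAt ℝ³ x₀).target) :
    ContMDiffAt 𝓘(ℝ, ℝ³) (𝓡 3) ∞ (chartAt ℝ³ x₀).symm u :=
  contMDiffAt_symm_of_mem_maximalAtlas (IsManifold.chart_mem_maximalAtlas x₀) hu

theorem contDiffOn_chartField (x₀ : N) {V : Π x : N, TangentSpace (𝓡 3) x}
    (hV : IsSmoothFieldOn V univ) : ContDiffOn ℝ ∞ (chartField x₀ V) (chartAt ℝ³ x₀).target := by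
  intro u hu
  refine ContDiffAt.contDiffWithinAt
    ((contMDiffAt_vectorSpace_iff_contDiffAt (V := chartField x₀ V)).1 ?_)
  exact ContMDiffAt.mpullback_vectorField_preimage (n := ∞)
    ((hV _ (mem_univ _)).contMDiffAt Filter.univ_mem) (contMDiffAt_chart_symm x₀ hu)
    (chartSymmDeriv_isInvertible x₀ hu) (by simp)

theorem mlieBracket_eq_lieBracket {F : Type*} [NormedAddCommGroup F] [NormedSpace ℝ F]
    (V W : F → F) : mlieBracket 𝓘(ℝ, F) V W = lieBracket ℝ V W :=
  (mlieBracketWithin_univ (I := 𝓘(ℝ, F)) (V := V) (W := W)).symm.trans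
    (mlieBracketWithin_eq_lieBracketWithin.trans lieBracketWithin_univ)

theorem chartField_mlieBracket (x₀ : N) {V W : Π x : N, TangentSpace (𝓡 3) x} {u : ℝ³}
    (hu : u ∈ (chartAt ℝ³ x₀).target)
    (hV : IsSmoothFieldOn V (chartAt ℝ³ x₀).source)
    (hW : IsSmoothFieldOn W (chartAt ℝ³ x₀).source) :
    chartField x₀ (mlieBracket (𝓡 3) V W) u =
      lieBracket ℝ (chartField x₀ V) (chartField x₀ W) u := by
  have hx := (chartAt ℝ³ x₀).map_target hu
  have hn := (chartAt ℝ³ x₀).open_source.mem_nhds hx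
  have h2 : minSmoothness ℝ 2 ≤ ∞ := by
    simpa using! WithTop.coe_le_coe.2 (le_top : (2 : ℕ∞) ≤ ⊤)
  have : IsManifold (𝓡 3) (minSmoothness ℝ 2) N := .of_le (n := ∞) h2
  have := mpullback_mlieBracket (((hV _ hx).contMDiffAt hn).mdifferentiableAt (by simp))
    (((hW _ hx).contMDiffAt hn).mdifferentiableAt (by simp)) (contMDiffAt_chart_symm x₀ hu)
    h2
  exact this.trans (congrFun (mlieBracket_eq_lieBracket (chartField x₀ V) (chartField x₀ W)) u)

/-- The expression of a Lorentz metric in the chart at `x₀`. -/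
def chartMetric (h : LorentzMetric N) (x₀ : N) (u : ℝ³) : ℝ³ →L[ℝ] ℝ³ →L[ℝ] ℝ :=
  ContinuousLinearMap.bilinearComp (E := ℝ³) (F := ℝ³) (h.inner ((chartAt ℝ³ x₀).symm u))
    (chartSymmDeriv x₀ u) (chartSymmDeriv x₀ u)

theorem chartMetric_apply (h : LorentzMetric N) (x₀ : N) (u v w : ℝ³) :
    chartMetric h x₀ u v w = h.inner ((chartAt ℝ³ x₀).symm u) (chartSymmDeriv x₀ u v)
      (chartSymmDeriv x₀ u w) := rfl

theorem chartMetric_chartDeriv (h : LorentzMetric N) (x₀ : N) {u : ℝ³}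
    (hu : u ∈ (chartAt ℝ³ x₀).target) (v w : TangentSpace (𝓡 3) ((chartAt ℝ³ x₀).symm u)) :
    chartMetric h x₀ u (chartDeriv x₀ _ v) (chartDeriv x₀ _ w) = h.inner _ v w := by
  rw [chartMetric_apply, chartSymmDeriv_chartDeriv x₀ hu, chartSymmDeriv_chartDeriv x₀ hu]

theorem chartMetric_chartField (h : LorentzMetric N) (x₀ : N) {u : ℝ³}
    (hu : u ∈ (chartAt ℝ³ x₀).target) (V W : Π x : N, TangentSpace (𝓡 3) x) :
    chartMetric h x₀ u (chartField x₀ V u) (chartField x₀ W u) =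
      h.inner ((chartAt ℝ³ x₀).symm u) (V _) (W _) := by
  rw [chartMetric_apply, chartSymmDeriv_chartField x₀ V hu, chartSymmDeriv_chartField x₀ W hu]

theorem isLorentzForm_chartMetric (h : LorentzMetric N) (x₀ : N) {u : ℝ³}
    (hu : u ∈ (chartAt ℝ³ x₀).target) : IsLorentzForm (chartMetric h x₀ u) := by
  obtain ⟨ι, hι⟩ := h.lorentzian ((chartAt ℝ³ x₀).symm u)
  obtain ⟨e, he⟩ := chartSymmDeriv_isInvertible x₀ hu
  have he' : ∀ v, chartSymmDeriv x₀ u v = e v := fun v ↦ DFunLike.congr_fun he.symm v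
  let ε : ℝ³ ≃ₗ[ℝ] TangentSpace (𝓡 3) ((chartAt ℝ³ x₀).symm u) := e.toLinearEquiv
  refine ⟨ε.trans ι, fun v w ↦ ?_⟩
  rw [chartMetric_apply, hι, he', he']
  rfl

theorem contMDiffOn_inner (h : LorentzMetric N) {U : Set N} {V W : Π x : N, TangentSpace (𝓡 3) x}
    (hV : IsSmoothFieldOn V U) (hW : IsSmoothFieldOn W U) :
    ContMDiffOn (𝓡 3) 𝓘(ℝ, ℝ) ∞ (fun x ↦ h.inner x (V x) (W x)) U := by
  intro x hx
  have := ContMDiffWithinAt.clm_bundle_apply₂ (F₁ := ℝ³) (F₂ := ℝ³) (F₃ := ℝ)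
    (E₁ := fun x : N ↦ TangentSpace (𝓡 3) x) (E₂ := fun x : N ↦ TangentSpace (𝓡 3) x)
    (E₃ := Bundle.Trivial N ℝ) (b := id) (h.contMDiff.contMDiffAt.contMDiffWithinAt (s := U)) (hV x hx)
    (hW x hx)
  rw [Bundle.contMDiffWithinAt_totalSpace] at this
  exact this.2

theorem inner_chartConst (h : LorentzMetric N) (x₀ : N) {x : N} (hx : x ∈ (chartAt ℝ³ x₀).source)
    (v w : ℝ³) : h.inner x (chartConst x₀ v x) (chartConst x₀ w x) =
      chartMetric h x₀ (chartAt ℝ³ x₀ x) v w := by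
  have hu := (chartAt ℝ³ x₀).map_source hx
  have := chartMetric_chartField h x₀ hu (chartConst x₀ v) (chartConst x₀ w)
  rw [chartField_chartConst x₀ v hu, chartField_chartConst x₀ w hu] at this
  rw [this, (chartAt ℝ³ x₀).left_inv hx]

theorem contDiffOn_chartMetric (h : LorentzMetric N) (x₀ : N) :
    ContDiffOn ℝ ∞ (chartMetric h x₀) (chartAt ℝ³ x₀).target := by
  rw [contDiffOn_clm_apply]
  intro v
  rw [contDiffOn_clm_apply]
  intro w
  have := (contMDiffOn_inner h (isSmoothFieldOn_chartConst x₀ v) (isSmoothFieldOn_chartConst x₀ w)).comp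
    (contMDiffOn_chart_symm (I := 𝓡 3) (x := x₀)) (fun u hu ↦ (chartAt ℝ³ x₀).map_target hu)
  rw [← contMDiffOn_iff_contDiffOn]
  refine this.congr fun u hu ↦ ?_
  rw [Function.comp_apply, inner_chartConst h x₀ ((chartAt ℝ³ x₀).map_target hu),
    (chartAt ℝ³ x₀).right_inv hu]

/-- The invariant Killing equation is tested on fields constant in the chart, for which the bracket
`[X, v]` reads `-DX(v)`. -/
theorem IsKilling.solvesKillingOn {h : LorentzMetric N} {X : Π x : N, TangentSpace (𝓡 3) x}
    (hX : IsKilling h X) (x₀ : N) :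
    SolvesKillingOn (chartMetric h x₀) (chartField x₀ X) (chartAt ℝ³ x₀).target := by
  intro u hu v w
  set c := chartAt ℝ³ x₀ with hc
  have hx := c.map_target hu
  have hK := hX.2 c.source (chartConst x₀ v) (chartConst x₀ w) c.open_source
    (isSmoothFieldOn_chartConst x₀ v) (isSmoothFieldOn_chartConst x₀ w) _ hx
  have hb : ∀ v : ℝ³, chartDeriv x₀ _ (mlieBracket (𝓡 3) X (chartConst x₀ v) (c.symm u)) =
      - fderiv ℝ (chartField x₀ X) u v := by
    intro v
    rw [← chartField_eq x₀ (mlieBracket (𝓡 3) X (chartConst x₀ v)) hu,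
      chartField_mlieBracket x₀ hu (hX.1.mono (subset_univ _)) (isSmoothFieldOn_chartConst x₀ v)]
    have : chartField x₀ (chartConst x₀ v) =ᶠ[nhds u] fun _ ↦ v :=
      Filter.eventually_of_mem (c.open_target.mem_nhds hu) fun y hy ↦ chartField_chartConst x₀ v hy
    rw [lieBracket, this.fderiv_eq, this.self_of_nhds]
    simp
  have hv : ∀ v : ℝ³, chartDeriv x₀ _ (chartConst x₀ v (c.symm u)) = v := fun v ↦ by
    rw [← chartField_eq x₀ _ hu, chartField_chartConst x₀ v hu]
  rw [← chartMetric_chartDeriv h x₀ hu, ← chartMetric_chartDeriv h x₀ hu, hb, hb, hv, hv] at hK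
  have hd : DifferentiableAt ℝ (chartMetric h x₀) u :=
    ((contDiffOn_chartMetric h x₀).differentiableOn (by simp)).differentiableAt
      (c.open_target.mem_nhds hu)
  have hL : differential (fun y ↦ h.inner y (chartConst x₀ v y) (chartConst x₀ w y)) (c.symm u)
      (X (c.symm u)) = fderiv ℝ (chartMetric h x₀) u (chartField x₀ X u) v w := by
    have he : (fun y ↦ h.inner y (chartConst x₀ v y) (chartConst x₀ w y)) =ᶠ[nhds (c.symm u)]
        (fun z ↦ chartMetric h x₀ z v w) ∘ c :=
      Filter.eventually_of_mem (c.open_source.mem_nhds hx) fun y hy ↦ inner_chartConst h x₀ hy v w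
    have hf : HasFDerivAt (fun z ↦ chartMetric h x₀ z v w)
        (((fderiv ℝ (chartMetric h x₀) u).flip v).flip w) u := by
      simpa using! (hd.hasFDerivAt.clm_apply (hasFDerivAt_const v u)).clm_apply
        (hasFDerivAt_const w u)
    have hcd : HasMFDerivAt (𝓡 3) 𝓘(ℝ, ℝ³) c (c.symm u) (chartDeriv x₀ (c.symm u)) :=
      ((chart_mdifferentiable x₀).mdifferentiableAt hx).hasMFDerivAt
    have hf' : HasMFDerivAt 𝓘(ℝ, ℝ³) 𝓘(ℝ, ℝ) (fun z ↦ chartMetric h x₀ z v w) (c (c.symm u))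
        (((fderiv ℝ (chartMetric h x₀) u).flip v).flip w) := by
      rw [c.right_inv hu]
      exact hf.hasMFDerivAt
    have := ((hf'.comp (c.symm u) hcd).congr_of_eventuallyEq he).mfderiv
    rw [differential, this, chartField_eq x₀ X hu]
    rfl
  rw [hL] at hK
  rw [hK]
  simp

end ChartTransport

/-! ### Rigidity and zeros of Killing fields on the manifold -/

section KillingFieldsOnManifold

variable {N : Type*} [TopologicalSpace N] [ChartedSpace ℝ³ N] [IsManifold (𝓡 3) ∞ N]

theorem eq_zero_of_chartField_eq_zero {x₀ y : N} (hy : y ∈ (chartAt ℝ³ x₀).source)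
    {X : Π x : N, TangentSpace (𝓡 3) x} (h0 : chartField x₀ X (chartAt ℝ³ x₀ y) = 0) : X y = 0 := by
  have := chartSymmDeriv_chartField x₀ X ((chartAt ℝ³ x₀).map_source hy)
  rw [h0, map_zero, (chartAt ℝ³ x₀).left_inv hy] at this
  exact this.symm

theorem chartField_eq_zero {x₀ y : N} (hy : y ∈ (chartAt ℝ³ x₀).source)
    {X : Π x : N, TangentSpace (𝓡 3) x} (h0 : X y = 0) :
    chartField x₀ X (chartAt ℝ³ x₀ y) = 0 := by
  have h1 : X ((chartAt ℝ³ x₀).symm (chartAt ℝ³ x₀ y)) = 0 := by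
    rw [(chartAt ℝ³ x₀).left_inv hy]
    exact h0
  rw [chartField_eq x₀ X ((chartAt ℝ³ x₀).map_source hy), h1, map_zero]

theorem IsKilling.eventually_eq_zero {h : LorentzMetric N} {X : Π x : N, TangentSpace (𝓡 3) x}
    (hX : IsKilling h X) {x : N} (h0 : chartField x X (chartAt ℝ³ x x) = 0)
    (h1 : fderiv ℝ (chartField x X) (chartAt ℝ³ x x) = 0) : ∀ᶠ y in nhds x, X y = 0 := by
  have hx := mem_chart_source ℝ³ x
  have hu := (chartAt ℝ³ x).map_source hx
  have := (hX.solvesKillingOn x).eventually_eq_zero (chartAt ℝ³ x).open_target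
    (contDiffOn_chartMetric h x) (contDiffOn_chartField x hX.1)
    (fun u hu ↦ (isLorentzForm_chartMetric h x hu).symm) hu
    (fun v hv ↦ (isLorentzForm_chartMetric h x hu).nondegenerate hv) h0 h1
  filter_upwards [((chartAt ℝ³ x).continuousAt hx).eventually this,
    (chartAt ℝ³ x).open_source.mem_nhds hx] with y hy hys
  exact eq_zero_of_chartField_eq_zero hys hy

/-- On a connected Lorentz manifold, a Killing field with vanishing `1`-jet at a point is zero. -/
theorem IsKilling.eq_zero_of_jet_eq_zero [ConnectedSpace N] {h : LorentzMetric N}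
    {X : Π x : N, TangentSpace (𝓡 3) x} (hX : IsKilling h X) {p : N}
    (h0 : chartField p X (chartAt ℝ³ p p) = 0)
    (h1 : fderiv ℝ (chartField p X) (chartAt ℝ³ p p) = 0) : X = 0 := by
  -- `S` is open by construction. At a point of its closure the 1-jet of `X` vanishes by continuity,
  -- and local unique continuation puts the point back in `S`.
  set S : Set N := {x | ∀ᶠ y in nhds x, X y = 0} with hS
  have hopen : IsOpen S := isOpen_iff_mem_nhds.2 fun x hx ↦ eventually_eventually_nhds.2 hx
  have hclosed : IsClosed S := by
    refine isClosed_of_closure_subset fun x hx ↦ ?_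
    rw [mem_closure_iff_frequently] at hx
    have hxs := mem_chart_source ℝ³ x
    have hu := (chartAt ℝ³ x).map_source hxs
    have hc := (chartAt ℝ³ x).continuousAt hxs
    have hXs := contDiffOn_chartField x hX.1
    have hfr : ∃ᶠ y in nhds x, chartField x X (chartAt ℝ³ x y) = 0 ∧
        fderiv ℝ (chartField x X) (chartAt ℝ³ x y) = 0 := by
      refine (hx.and_eventually ((chartAt ℝ³ x).open_source.mem_nhds hxs)).mono fun y hy ↦ ?_
      obtain ⟨hyS, hys⟩ := hy
      have hyt := (chartAt ℝ³ x).map_source hys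
      have hz : chartField x X =ᶠ[nhds (chartAt ℝ³ x y)] fun _ ↦ 0 := by
        have hcs := (chartAt ℝ³ x).continuousAt_symm hyt
        rw [ContinuousAt, (chartAt ℝ³ x).left_inv hys] at hcs
        filter_upwards [hcs.eventually hyS, (chartAt ℝ³ x).open_target.mem_nhds hyt] with u hu hut
        rw [chartField_eq x X hut, hu, map_zero]
      refine ⟨hz.self_of_nhds, ?_⟩
      rw [hz.fderiv_eq]
      simp
    have c0 : ContinuousAt (fun y ↦ chartField x X (chartAt ℝ³ x y)) x :=
      ContinuousAt.comp (f := chartAt ℝ³ x)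
        (hXs.continuousOn.continuousAt ((chartAt ℝ³ x).open_target.mem_nhds hu)) hc
    have c1 : ContinuousAt (fun y ↦ fderiv ℝ (chartField x X) (chartAt ℝ³ x y)) x :=
      ContinuousAt.comp (f := chartAt ℝ³ x)
        ((hXs.continuousOn_fderiv_of_isOpen (chartAt ℝ³ x).open_target (by simp)).continuousAt
        ((chartAt ℝ³ x).open_target.mem_nhds hu)) hc
    refine hX.eventually_eq_zero ?_ ?_
    · by_contra hne
      exact hfr ((c0.eventually_ne hne).mono fun y hy hy' ↦ hy hy'.1)
    · by_contra hne
      exact hfr ((c1.eventually_ne hne).mono fun y hy hy' ↦ hy hy'.2)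
  have huniv : S = univ := IsClopen.eq_univ ⟨hclosed, hopen⟩ ⟨p, hX.eventually_eq_zero h0 h1⟩
  funext x
  have hx : x ∈ S := huniv ▸ mem_univ x
  exact Filter.Eventually.self_of_nhds (p := fun y ↦ X y = 0) hx

theorem LorentzMetric.symm (h : LorentzMetric N) (x : N) (v w : TangentSpace (𝓡 3) x) :
    h.inner x v w = h.inner x w v := by
  obtain ⟨ι, hι⟩ := h.lorentzian x
  rw [hι, hι, minkowski, minkowski]
  ring

/-- In the Killing equation with both arguments equal to `W`, the left side is a derivative in the
direction `U p = 0`. -/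
theorem IsKilling.inner_mlieBracket_eq_zero {h : LorentzMetric N}
    {U W : Π x : N, TangentSpace (𝓡 3) x} (hU : IsKilling h U) (hW : IsSmoothFieldOn W univ)
    {p : N} (hp : U p = 0) : h.inner p (mlieBracket (𝓡 3) U W p) (W p) = 0 := by
  have := hU.2 univ W W isOpen_univ hW hW p (mem_univ p)
  rw [hp, map_zero, h.symm p (W p)] at this
  linarith

/-- Let `Z` be a nontrivial Killing field vanishing at `p`. The values at `p` of the fields commuting
with `Z` lie on a line, and so do the linear parts of the Killing fields commuting with `Z` which
vanish at `p`. -/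
theorem IsKilling.exists_axis [ConnectedSpace N] {h : LorentzMetric N}
    {Z : Π x : N, TangentSpace (𝓡 3) x} (hZ : IsKilling h Z) (hZ0 : Z ≠ 0) {p : N} (hp : Z p = 0) :
    ∃ m : ℝ³, ∀ V : Π x : N, TangentSpace (𝓡 3) x, IsKilling h V → mlieBracket (𝓡 3) Z V = 0 →
      (∃ t : ℝ, chartField p V (chartAt ℝ³ p p) = t • m) ∧
      (V p = 0 → ∃ t : ℝ, fderiv ℝ (chartField p V) (chartAt ℝ³ p p) =
        t • fderiv ℝ (chartField p Z) (chartAt ℝ³ p p)) := by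
  have hps := mem_chart_source ℝ³ p
  set u := chartAt ℝ³ p p with hu
  have hut : u ∈ (chartAt ℝ³ p).target := (chartAt ℝ³ p).map_source hps
  have hopen := (chartAt ℝ³ p).open_target
  have hn := hopen.mem_nhds hut
  have z0 : chartField p Z u = 0 := chartField_eq_zero hps hp
  have hA : fderiv ℝ (chartField p Z) u ≠ 0 := fun h1 ↦ hZ0 (hZ.eq_zero_of_jet_eq_zero z0 h1)
  -- At a zero of `V` the derivative of the metric drops out of the Killing equation: the linear
  -- part of `V` is skew.
  have skew : ∀ V : Π x : N, TangentSpace (𝓡 3) x, IsKilling h V → chartField p V u = 0 →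
      ∀ v w, chartMetric h p u (fderiv ℝ (chartField p V) u v) w +
        chartMetric h p u v (fderiv ℝ (chartField p V) u w) = 0 := by
    intro V hV v0 v w
    have := hV.solvesKillingOn p u hut v w
    simpa [v0] using this
  obtain ⟨m, hm, hm'⟩ := (isLorentzForm_chartMetric h p hut).exists_axis (skew Z hZ z0) hA
  refine ⟨m, fun V hV hZV ↦ ?_⟩
  have hb : ∀ y ∈ (chartAt ℝ³ p).target,
      fderiv ℝ (chartField p V) y (chartField p Z y) - fderiv ℝ (chartField p Z) y (chartField p V y)
        = 0 := by
    intro y hy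
    have := chartField_mlieBracket p hy (hZ.1.mono (subset_univ _)) (hV.1.mono (subset_univ _))
    rw [hZV, chartField, mpullback_zero] at this
    exact this.symm
  -- At the zero of `Z`, `[Z, V] = 0` says that `V p` is in the kernel of the linear part of `Z`. If
  -- `V` vanishes there too, differentiating `[Z, V] = 0` once loses its second-order terms and says
  -- that the two linear parts commute.
  refine ⟨hm _ ?_, fun hVp ↦ ?_⟩
  · have := hb u hut
    rw [z0, map_zero, zero_sub, neg_eq_zero] at this
    exact this
  · have v0 : chartField p V u = 0 := chartField_eq_zero hps hVp
    refine hm' _ (skew V hV v0) fun v ↦ ?_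
    have dV := contDiffOn_chartField p hV.1
    have dZ := contDiffOn_chartField p hZ.1
    have dV1 := ((dV.differentiableOn (by simp)).differentiableAt hn).hasFDerivAt
    have dZ1 := ((dZ.differentiableOn (by simp)).differentiableAt hn).hasFDerivAt
    have dV2 := (((dV.fderiv_of_isOpen hopen (m := ∞) (by simp)).differentiableOn
      (by simp)).differentiableAt hn).hasFDerivAt
    have dZ2 := (((dZ.fderiv_of_isOpen hopen (m := ∞) (by simp)).differentiableOn
      (by simp)).differentiableAt hn).hasFDerivAt
    have e := DFunLike.congr_fun (((dV2.clm_apply dZ1).sub (dZ2.clm_apply dV1)).fderiv.symm.trans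
      (fderiv_eq_zero_of_eqOn_const hopen hb hut)) v
    simp [z0, v0] at e
    exact (sub_eq_zero.1 e).symm

end KillingFieldsOnManifold

/-! ### Tangent spaces of pseudo-orbits -/

section PseudoOrbits

variable {N : Type*} [TopologicalSpace N] [ChartedSpace ℝ³ N] [IsManifold (𝓡 3) ∞ N]

/-- In the chart, the velocity is a continuous field evaluated along a continuous curve, hence is
continuous. -/
theorem IsMIntegralCurveOn.contMDiffOn_one {X : Π x : N, TangentSpace (𝓡 3) x}
    (hX : IsSmoothFieldOn X univ) {γ : ℝ → N} {x₀ : N} {I : Set ℝ} (hI : IsOpen I)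
    (hγ : IsMIntegralCurveOn γ X I) (hs : ∀ t ∈ I, γ t ∈ (chartAt ℝ³ x₀).source) :
    ContMDiffOn 𝓘(ℝ, ℝ) (𝓡 3) 1 γ I := by
  set c := chartAt ℝ³ x₀ with hc
  have hder : ∀ t ∈ I, HasDerivAt (c ∘ γ) (chartField x₀ X (c (γ t))) t := by
    intro t ht
    have h1 := (hγ t ht).hasMFDerivAt (hI.mem_nhds ht)
    have h2 : HasMFDerivAt (𝓡 3) 𝓘(ℝ, ℝ³) c (γ t) (chartDeriv x₀ (γ t)) :=
      ((chart_mdifferentiable x₀).mdifferentiableAt (hs t ht)).hasMFDerivAt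
    have h3 : chartField x₀ X (c (γ t)) = chartDeriv x₀ (γ t) (X (γ t)) := by
      rw [chartField_eq x₀ X (c.map_source (hs t ht)), c.left_inv (hs t ht)]
    have h4 : ((1 : ℝ →L[ℝ] ℝ).smulRight (chartField x₀ X (c (γ t))) : ℝ →L[ℝ] ℝ³) =
        (chartDeriv x₀ (γ t)).comp ((1 : ℝ →L[ℝ] ℝ).smulRight (X (γ t))) := by
      refine ContinuousLinearMap.ext fun s ↦ ?_
      rw [h3]
      exact (map_smul (chartDeriv x₀ (γ t)) s (X (γ t))).symm
    have h5 : HasFDerivAt (c ∘ γ) ((1 : ℝ →L[ℝ] ℝ).smulRight (chartField x₀ X (c (γ t)))) t := by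
      rw [h4]
      exact (h2.comp t h1).hasFDerivAt
    simpa using h5.hasDerivAt
  have hcont : ContinuousOn (c ∘ γ) I := fun t ht ↦ (hder t ht).continuousAt.continuousWithinAt
  have hC1 : ContDiffOn ℝ 1 (c ∘ γ) I := by
    rw [show (1 : WithTop ℕ∞) = 0 + 1 by simp, contDiffOn_succ_iff_deriv_of_isOpen hI]
    refine ⟨fun t ht ↦ (hder t ht).differentiableAt.differentiableWithinAt, by simp, ?_⟩
    rw [contDiffOn_zero]
    refine ContinuousOn.congr ?_ fun t ht ↦ (hder t ht).deriv
    exact (contDiffOn_chartField x₀ hX).continuousOn.comp hcont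
      fun t ht ↦ c.map_source (hs t ht)
  have := ((contMDiffOn_chart_symm (I := 𝓡 3) (n := ∞) (x := x₀)).of_le (m := 1) (by simp)).comp
    hC1.contMDiffOn (fun t ht ↦ c.map_source (hs t ht))
  exact this.congr fun t ht ↦ (c.left_inv (hs t ht)).symm

/-- A short integral curve of `X` through `y` stays in the pseudo-orbit and has velocity `X y`. -/
theorem apply_mem_tangentSpan_pseudoOrbit {𝔫 : Submodule ℝ (Π x : N, TangentSpace (𝓡 3) x)}
    {X : Π x : N, TangentSpace (𝓡 3) x} (hX : X ∈ 𝔫) (hXs : IsSmoothFieldOn X univ) {x y : N}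
    (hy : y ∈ pseudoOrbit 𝔫 x) : X y ∈ tangentSpan (pseudoOrbit 𝔫 x) y := by
  have : IsManifold (𝓡 3) 1 N := .of_le (n := ∞) (by simp)
  obtain ⟨γ, h0, hγ⟩ := exists_isMIntegralCurveAt_of_contMDiffAt_boundaryless (I := 𝓡 3) (x₀ := y) 0
    (((hXs y (mem_univ y)).contMDiffAt Filter.univ_mem).of_le (by simp))
  have hsrc : ∀ᶠ t in nhds 0, γ t ∈ (chartAt ℝ³ y).source :=
    hγ.continuousAt.eventually (by
      rw [h0]; exact (chartAt ℝ³ y).open_source.mem_nhds (mem_chart_source ℝ³ y))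
  obtain ⟨ε₁, hε₁, h₁⟩ := isMIntegralCurveAt_iff'.1 hγ
  obtain ⟨ε₂, hε₂, h₂⟩ := Metric.eventually_nhds_iff_ball.1 hsrc
  set ε := min ε₁ ε₂ with hε
  have hε0 : 0 < ε := lt_min hε₁ hε₂
  have hball : ∀ t ∈ Ioo (-ε) ε, t ∈ Metric.ball 0 ε₁ ∧ t ∈ Metric.ball 0 ε₂ := by
    intro t ht
    have : |t| < ε := abs_lt.2 ht
    simp only [Metric.mem_ball, Real.dist_eq, sub_zero]
    exact ⟨this.trans_le (min_le_left _ _), this.trans_le (min_le_right _ _)⟩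
  have hint : IsMIntegralCurveOn γ X (Ioo (-ε) ε) := h₁.mono fun t ht ↦ (hball t ht).1
  have hz : (0 : ℝ) ∈ Ioo (-ε) ε := ⟨by linarith, hε0⟩
  refine Submodule.subset_span ⟨γ, ε, hε0, hint.contMDiffOn_one hXs isOpen_Ioo
    fun t ht ↦ h₂ t (hball t ht).2, fun t ht ↦ hy.tail ?_, ?_⟩
  · exact ⟨X, hX, γ, -ε, ε, 0, t, hz, ht, hint, h0, rfl⟩
  · have hd := (hint 0 hz).hasMFDerivAt (isOpen_Ioo.mem_nhds hz)
    rw [hd.mfderiv]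
    subst h0
    congr 1
    exact one_smul ℝ (X (γ 0))

end PseudoOrbits

/-! ### Heisenberg algebras of Killing fields -/

section HeisenbergFields

attribute [local instance] LieRing.ofAssociativeRing

/-- The strictly upper triangular matrix with entries `a, b` above the diagonal and corner `c`. -/
def heisMatrix (a b c : ℝ) : heis :=
  ⟨!![0, a, c; 0, 0, b; 0, 0, 0], by
    intro i j hij
    fin_cases i <;> fin_cases j <;> simp_all⟩

theorem heisMatrix_lie (a b c a' b' c' : ℝ) :
    ⁅heisMatrix a b c, heisMatrix a' b' c'⁆ = heisMatrix 0 0 (a * b' - a' * b) := by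
  apply Subtype.ext
  rw [LieSubalgebra.coe_bracket, Ring.lie_def]
  ext i j
  fin_cases i <;> fin_cases j <;> simp [heisMatrix]

theorem heisMatrix_eq (a b c : ℝ) : heisMatrix a b c =
    a • heisMatrix 1 0 0 + b • heisMatrix 0 1 0 + c • heisMatrix 0 0 1 := by
  apply Subtype.ext
  change (heisMatrix a b c).1 =
    a • (heisMatrix 1 0 0).1 + b • (heisMatrix 0 1 0).1 + c • (heisMatrix 0 0 1).1
  ext i j
  fin_cases i <;> fin_cases j <;> simp [heisMatrix]

theorem heisMatrix_eq_zero {a b c : ℝ} (h : heisMatrix a b c = 0) : a = 0 ∧ b = 0 ∧ c = 0 := by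
  have h' : (heisMatrix a b c).1 = 0 := congrArg Subtype.val h
  have h01 := congrFun (congrFun h' 0) 1
  have h12 := congrFun (congrFun h' 1) 2
  have h02 := congrFun (congrFun h' 0) 2
  exact ⟨by simpa [heisMatrix] using h01, by simpa [heisMatrix] using h12,
    by simpa [heisMatrix] using h02⟩

variable {N : Type*} [TopologicalSpace N] [ChartedSpace ℝ³ N] [IsManifold (𝓡 3) ∞ N]

/-- The Killing fields `X, Y, Z` are linearly independent, with `[X, Y] = Z` central. -/
structure IsHeisenbergTriple (h : LorentzMetric N) (X Y Z : Π x : N, TangentSpace (𝓡 3) x) :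
    Prop where
  killing (a b c : ℝ) : IsKilling h (a • X + b • Y + c • Z)
  bracket (a b c a' b' c' : ℝ) : mlieBracket (𝓡 3) (a • X + b • Y + c • Z)
    (a' • X + b' • Y + c' • Z) = (a * b' - a' * b) • Z
  independent (a b c : ℝ) : a • X + b • Y + c • Z = 0 → a = 0 ∧ b = 0 ∧ c = 0

theorem IsHeisKillingAlgebra.exists_triple {h : LorentzMetric N}
    {𝔫 : Submodule ℝ (Π x : N, TangentSpace (𝓡 3) x)} (h𝔫 : IsHeisKillingAlgebra h 𝔫) :
    ∃ X ∈ 𝔫, ∃ Y ∈ 𝔫, ∃ Z ∈ 𝔫, IsHeisenbergTriple h X Y Z := by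
  obtain ⟨hK, e, he⟩ := h𝔫
  have key : ∀ a b c : ℝ, (e (heisMatrix a b c) : Π x : N, TangentSpace (𝓡 3) x) =
      a • (e (heisMatrix 1 0 0) : Π x : N, TangentSpace (𝓡 3) x) +
      b • (e (heisMatrix 0 1 0) : Π x : N, TangentSpace (𝓡 3) x) +
      c • (e (heisMatrix 0 0 1) : Π x : N, TangentSpace (𝓡 3) x) := by
    intro a b c
    rw [heisMatrix_eq, map_add, map_add, map_smul, map_smul, map_smul]
    rfl
  refine ⟨_, (e (heisMatrix 1 0 0)).2, _, (e (heisMatrix 0 1 0)).2, _, (e (heisMatrix 0 0 1)).2,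
    fun a b c ↦ ?_, fun a b c a' b' c' ↦ ?_, fun a b c h0 ↦ ?_⟩
  · rw [← key]
    exact hK _ (e _).2
  · rw [← key, ← key, ← he, heisMatrix_lie, key]
    simp
  · rw [← key] at h0
    exact heisMatrix_eq_zero (e.map_eq_zero_iff.1 (Subtype.ext h0))

variable {h : LorentzMetric N} {X Y Z : Π x : N, TangentSpace (𝓡 3) x}

theorem IsHeisenbergTriple.killing_center (H : IsHeisenbergTriple h X Y Z) : IsKilling h Z := by
  simpa using H.killing 0 0 1

theorem IsHeisenbergTriple.center_bracket (H : IsHeisenbergTriple h X Y Z) (a b c : ℝ) :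
    mlieBracket (𝓡 3) Z (a • X + b • Y + c • Z) = 0 := by
  simpa using H.bracket 0 0 1 a b c

theorem IsHeisenbergTriple.bracket_center (H : IsHeisenbergTriple h X Y Z) (a b c : ℝ) :
    mlieBracket (𝓡 3) (a • X + b • Y + c • Z) Z = 0 := by
  simpa using H.bracket a b c 0 0 1

/-- If `Z p = 0`, the values of `X` and `Y` at `p` lie on one line, so a nontrivial combination `U`
of `X` and `Y` vanishes at `p`. Its linear part is then `r` times that of `Z`, so `U - r Z` has zero
1-jet and vanishes identically, against linear independence. -/
theorem IsHeisenbergTriple.center_ne_zero [ConnectedSpace N] (H : IsHeisenbergTriple h X Y Z)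
    (p : N) : Z p ≠ 0 := by
  intro hp
  have hps := mem_chart_source ℝ³ p
  have hn := (chartAt ℝ³ p).open_target.mem_nhds ((chartAt ℝ³ p).map_source hps)
  obtain ⟨m, hm⟩ := H.killing_center.exists_axis (fun h0 ↦ by
    have := H.independent 0 0 1 (by simp [h0])
    simp at this) hp
  have hX : IsKilling h X := by simpa using H.killing 1 0 0
  have hY : IsKilling h Y := by simpa using H.killing 0 1 0
  obtain ⟨s, hs⟩ := (hm X hX (by simpa using H.center_bracket 1 0 0)).1
  obtain ⟨t, ht⟩ := (hm Y hY (by simpa using H.center_bracket 0 1 0)).1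
  obtain ⟨a, b, hab, hst⟩ : ∃ a b : ℝ, ¬ (a = 0 ∧ b = 0) ∧ a * s + b * t = 0 := by
    by_cases h0 : s = 0
    · exact ⟨1, 0, by simp, by simp [h0]⟩
    · exact ⟨t, -s, by simp [h0], by ring⟩
  have hU : IsKilling h (a • X + b • Y) := by simpa using H.killing a b 0
  have hU0 : (a • X + b • Y) p = 0 := by
    apply eq_zero_of_chartField_eq_zero hps
    rw [chartField_add_smul, Pi.add_apply, Pi.smul_apply, Pi.smul_apply, hs, ht, smul_smul,
      smul_smul, ← add_smul, hst, zero_smul]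
  obtain ⟨r, hr⟩ := (hm _ hU (by simpa using H.center_bracket a b 0)).2 hU0
  have hW : IsKilling h ((1 : ℝ) • (a • X + b • Y) + (-r) • Z) := by
    simpa using H.killing a b (-r)
  have dU := ((contDiffOn_chartField p hU.1).differentiableOn (by simp)).differentiableAt hn
  have dZ := ((contDiffOn_chartField p H.killing_center.1).differentiableOn
    (by simp)).differentiableAt hn
  have hW0 := hW.eq_zero_of_jet_eq_zero (p := p)
    (chartField_eq_zero hps (by rw [Pi.add_apply, Pi.smul_apply, Pi.smul_apply, hU0, hp]; simp))
    (by
      rw [chartField_add_smul, fderiv_add (dU.const_smul _) (dZ.const_smul _),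
        fderiv_const_smul dU, fderiv_const_smul dZ, hr]
      simp)
  rw [one_smul] at hW0
  have := H.independent a b (-r) hW0
  exact hab ⟨this.1, this.2.1⟩

/-- If the values of the fields of a Heisenberg algebra at `p` are linearly dependent, then they
form a plane orthogonal to the center. -/
theorem IsHeisenbergTriple.lightlike (H : IsHeisenbergTriple h X Y Z) {p : N} (hZ : Z p ≠ 0)
    (hdep : ∃ a b c : ℝ, ¬ (a = 0 ∧ b = 0 ∧ c = 0) ∧ a • X p + b • Y p + c • Z p = 0) :
    (∀ a b c : ℝ, h.inner p (Z p) ((a • X + b • Y + c • Z) p) = 0) ∧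
      ∃ a b : ℝ, LinearIndependent ℝ ![(a • X + b • Y) p, Z p] := by
  obtain ⟨a, b, c, hne, h0⟩ := hdep
  have hU0 : (a • X + b • Y + c • Z) p = 0 := h0
  have hab : ¬ (a = 0 ∧ b = 0) := by
    rintro ⟨rfl, rfl⟩
    have hc : c ≠ 0 := fun hc ↦ hne ⟨rfl, rfl, hc⟩
    simp [hc, hZ] at h0
  have hd : a * a + b * b ≠ 0 := fun hd ↦ hab (mul_self_add_mul_self_eq_zero.1 hd)
  -- With `U` the combination vanishing at `p` and `W` the one with coefficients `a', b', c'`, `[U,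
  -- W] = (a b' - a' b) Z`; the Killing equation of `U` at `p` then gives `h(Z, W) = 0`.
  have orth : ∀ a' b' c' : ℝ, a * b' - a' * b ≠ 0 →
      h.inner p (Z p) ((a' • X + b' • Y + c' • Z) p) = 0 := by
    intro a' b' c' hne
    have := (H.killing a b c).inner_mlieBracket_eq_zero (H.killing a' b' c').1 hU0
    rw [H.bracket, Pi.smul_apply, map_smul] at this
    exact (mul_eq_zero.1 this).resolve_left hne
  -- The witness `-b X + a Y` has bracket `(a² + b²) Z` with `U`, a nonzero multiple. A field
  -- commuting with `U` is handled as a difference of two fields that do not.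
  refine ⟨fun a' b' c' ↦ ?_, -b, a, ?_⟩
  · by_cases hne : a * b' - a' * b = 0
    · have h1 := orth (-b) a 0 (by ring_nf; ring_nf at hd; exact hd)
      have h2 := orth (a' + -b) (b' + a) c' (by
        have : a * (b' + a) - (a' + -b) * b = a * a + b * b := by linear_combination hne
        rwa [this])
      have h3 : ((a' + -b) • X + (b' + a) • Y + c' • Z) p =
          (a' • X + b' • Y + c' • Z) p + ((-b) • X + a • Y + (0 : ℝ) • Z) p := by
        refine congrFun (?_ : _ = (a' • X + b' • Y + c' • Z) + ((-b) • X + a • Y + (0 : ℝ) • Z)) p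
        module
      rw [h3, map_add, h1, add_zero] at h2
      exact h2
    · exact orth a' b' c' hne
  · rw [LinearIndependent.pair_iff]
    intro s t hst
    have hW : ((s * -b) • X + (s * a) • Y + t • Z) p = 0 := by
      rw [← hst]
      refine congrFun (?_ : _ = s • ((-b) • X + a • Y) + t • Z) p
      module
    have hB := H.bracket a b c (s * -b) (s * a) t
    have hB' := congrFun hB p
    -- Two fields vanishing at `p` have a bracket vanishing at `p`; this bracket is `s (a² + b²) Z`,
    -- which forces `s = 0`.
    have hz : mlieBracket (𝓡 3) (a • X + b • Y + c • Z)
        ((s * -b) • X + (s * a) • Y + t • Z) p = 0 :=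
      mlieBracketWithin_eq_zero_of_eq_zero hU0 hW
    rw [hz, Pi.smul_apply, eq_comm, smul_eq_zero] at hB'
    have hs : s = 0 := by
      have := hB'.resolve_right hZ
      have h' : s * (a * a + b * b) = 0 := by linear_combination this
      exact (mul_eq_zero.1 h').resolve_right hd
    subst hs
    simp [hZ] at hst
    exact ⟨rfl, hst⟩

end HeisenbergFields

/-! ### Conformal charts on the manifold -/

section ConformalFlatness

variable {N : Type*} [TopologicalSpace N] [ChartedSpace ℝ³ N] [IsManifold (𝓡 3) ∞ N]

theorem LinearIndependent.chartField_pair {x : N} {V W : Π x : N, TangentSpace (𝓡 3) x}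
    (hi : LinearIndependent ℝ ![V x, W x]) :
    LinearIndependent ℝ ![chartField x V (chartAt ℝ³ x x), chartField x W (chartAt ℝ³ x x)] := by
  rw [LinearIndependent.pair_iff] at hi ⊢
  intro s t hst
  apply hi
  exact eq_zero_of_chartField_eq_zero (X := s • V + t • W) (mem_chart_source ℝ³ x)
    (by rw [chartField_add_smul]; exact hst)

/-- Two commuting Killing fields spanning lightlike planes make a Lorentz metric conformally flat. -/
theorem exists_conformal_chart_of_killing {h : LorentzMetric N}
    {V Z : Π x : N, TangentSpace (𝓡 3) x} (hV : IsKilling h V) (hZ : IsKilling h Z)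
    (hVZ : mlieBracket (𝓡 3) V Z = 0) (hzz : ∀ y, h.inner y (Z y) (Z y) = 0)
    (hzv : ∀ y, h.inner y (Z y) (V y) = 0) {x : N} (hi : LinearIndependent ℝ ![V x, Z x]) :
    ∃ φ ∈ IsManifold.maximalAtlas (𝓡 3) ∞ N, x ∈ φ.source ∧
    ∃ f : N → ℝ, ContMDiffOn (𝓡 3) 𝓘(ℝ, ℝ) ∞ f φ.source ∧ ∀ y ∈ φ.source, 0 < f y ∧
      ∀ v w : TangentSpace (𝓡 3) y, h.inner y v w =
        f y * minkowski (differential φ y v) (differential φ y w) := by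
  set c := chartAt ℝ³ x with hc
  have hxs : x ∈ c.source := mem_chart_source ℝ³ x
  obtain ⟨ψ, hxψ, hψΩ, hψ, hψs, f, hf, hfψ⟩ := exists_conformal_chart c.open_target
    (contDiffOn_chartMetric h x) (fun u hu ↦ isLorentzForm_chartMetric h x hu)
    (contDiffOn_chartField x hV.1) (contDiffOn_chartField x hZ.1) (hV.solvesKillingOn x)
    (hZ.solvesKillingOn x)
    (fun u hu ↦ by
      rw [← chartField_mlieBracket x hu (hV.1.mono (subset_univ _)) (hZ.1.mono (subset_univ _)),
        hVZ, chartField, mpullback_zero]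
      rfl)
    (fun u hu ↦ by rw [chartMetric_chartField h x hu, hzz])
    (fun u hu ↦ by rw [chartMetric_chartField h x hu, hzv]) (c.map_source hxs) hi.chartField_pair
  have hcs : ContMDiffOn (𝓡 3) 𝓘(ℝ, ℝ³) ∞ c c.source := contMDiffOn_chart
  have hcs' : ContMDiffOn 𝓘(ℝ, ℝ³) (𝓡 3) ∞ c.symm c.target := contMDiffOn_chart_symm
  refine ⟨c.trans ψ, OpenPartialHomeomorph.mem_maximalAtlas_of_contMDiffOn _ ?_ ?_, ⟨hxs, hxψ⟩,
    f ∘ c, ?_, fun y hy ↦ ⟨(hfψ (c y) hy.2).1, fun v w ↦ ?_⟩⟩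
  · exact hψ.contMDiffOn.comp (hcs.mono fun y hy ↦ hy.1) fun y hy ↦ hy.2
  · exact hcs'.comp (hψs.contMDiffOn.mono fun u hu ↦ hu.1) fun u hu ↦ hu.2
  · exact hf.contMDiffOn.comp (hcs.mono fun y hy ↦ hy.1) fun y hy ↦ hy.2
  · have hd : ∀ v, differential (c.trans ψ) y v = fderiv ℝ ψ (c y) (chartDeriv x y v) := by
      intro v
      have h1 : HasMFDerivAt (𝓡 3) 𝓘(ℝ, ℝ³) c y (chartDeriv x y) :=
        ((chart_mdifferentiable x).mdifferentiableAt hy.1).hasMFDerivAt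
      have h2 : HasMFDerivAt 𝓘(ℝ, ℝ³) 𝓘(ℝ, ℝ³) ψ (c y) (fderiv ℝ ψ (c y)) :=
        ((hψ.differentiableOn (by simp)).differentiableAt
          (ψ.open_source.mem_nhds hy.2)).hasFDerivAt.hasMFDerivAt
      exact DFunLike.congr_fun (h2.comp y h1).mfderiv v
    rw [hd, hd, Function.comp_apply, ← (hfψ (c y) hy.2).2]
    have := chartMetric_chartDeriv h x (c.map_source hy.1)
    rw [c.left_inv hy.1] at this
    exact (this v w).symm

end ConformalFlatness

end

/-! ### The main theorem -/

theorem mainTheorem12 {N : Type*} [TopologicalSpace N]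
    [ChartedSpace (EuclideanSpace ℝ (Fin 3)) N] [IsManifold (𝓡 3) ∞ N]
    [T2Space N] [ConnectedSpace N] (h : LorentzMetric N)
    (𝔫 : Submodule ℝ (Π x : N, TangentSpace (𝓡 3) x)) (h𝔫 : IsHeisKillingAlgebra h 𝔫)
    (hdim : ∀ x : N, ∀ y ∈ pseudoOrbit 𝔫 x,
      Module.finrank ℝ (tangentSpan (pseudoOrbit 𝔫 x) y) ≤ 2) :
    (∀ x : N, ∀ y ∈ pseudoOrbit 𝔫 x,
      Module.finrank ℝ (tangentSpan (pseudoOrbit 𝔫 x) y) = 2 ∧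
      IsLightlike h (tangentSpan (pseudoOrbit 𝔫 x) y)) ∧
    IsConformallyFlat h := by
  obtain ⟨X, hX, Y, hY, Z, hZ, H⟩ := h𝔫.exists_triple
  have hfin : ∀ p : N, FiniteDimensional ℝ (TangentSpace (𝓡 3) p) := fun p ↦
    inferInstanceAs (FiniteDimensional ℝ (EuclideanSpace ℝ (Fin 3)))
  have hmem : ∀ W ∈ 𝔫, ∀ x : N, ∀ y ∈ pseudoOrbit 𝔫 x, W y ∈ tangentSpan (pseudoOrbit 𝔫 x) y :=
    fun W hW x y hy ↦ apply_mem_tangentSpan_pseudoOrbit hW (h𝔫.1 W hW).1 hy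
  have hZ0 := H.center_ne_zero
  -- Three independent values of `𝔫` at `p` would lie in the tangent space of the pseudo-orbit,
  -- whose dimension is at most 2.
  have hdep : ∀ p : N, ∃ a b c : ℝ, ¬ (a = 0 ∧ b = 0 ∧ c = 0) ∧
      a • X p + b • Y p + c • Z p = 0 := by
    intro p
    by_contra hcon
    have hp : p ∈ pseudoOrbit 𝔫 p := Relation.ReflTransGen.refl
    have hli : LinearIndependent ℝ ![X p, Y p, Z p] := by
      rw [Fintype.linearIndependent_iff]
      intro g hg
      rw [Fin.sum_univ_three] at hg
      by_contra! hne
      refine hcon ⟨g 0, g 1, g 2, fun hz ↦ ?_, hg⟩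
      obtain ⟨i, hi⟩ := hne
      fin_cases i
      exacts [hi hz.1, hi hz.2.1, hi hz.2.2]
    have h1 := finrank_span_eq_card hli
    have h2 : Submodule.span ℝ (range ![X p, Y p, Z p]) ≤ tangentSpan (pseudoOrbit 𝔫 p) p := by
      rw [Submodule.span_le]
      rintro _ ⟨i, rfl⟩
      fin_cases i
      exacts [hmem X hX p p hp, hmem Y hY p p hp, hmem Z hZ p p hp]
    have h3 := Submodule.finrank_mono h2
    have h4 := hdim p p hp
    rw [h1, Fintype.card_fin] at h3
    omega
  have hlight := fun p ↦ H.lightlike (hZ0 p) (hdep p)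
  have hZZ : ∀ p, h.inner p (Z p) (Z p) = 0 := fun p ↦ by simpa using (hlight p).1 0 0 1
  have hZV : ∀ (a b : ℝ) (p : N), h.inner p (Z p) ((a • X + b • Y) p) = 0 := fun a b p ↦ by
    simpa using (hlight p).1 a b 0
  refine ⟨fun x y hy ↦ ?_, fun x ↦ ?_⟩
  · obtain ⟨a, b, hli⟩ := (hlight y).2
    have hV : a • X + b • Y ∈ 𝔫 := 𝔫.add_mem (𝔫.smul_mem a hX) (𝔫.smul_mem b hY)
    have h1 := finrank_span_eq_card hli
    have h2 : Submodule.span ℝ (range ![(a • X + b • Y) y, Z y]) ≤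
        tangentSpan (pseudoOrbit 𝔫 x) y := by
      rw [Submodule.span_le]
      rintro _ ⟨i, rfl⟩
      fin_cases i
      exacts [hmem _ hV x y hy, hmem Z hZ x y hy]
    have h3 := Submodule.finrank_mono h2
    have h4 := hdim x y hy
    rw [h1, Fintype.card_fin] at h3
    have h5 := le_antisymm h4 h3
    -- The tangent space is exactly the plane of `a X + b Y` and `Z`, both orthogonal to `Z`; so `Z
    -- y` witnesses the degeneracy.
    have h6 := Submodule.eq_of_le_of_finrank_eq h2 (by rw [h1, h5, Fintype.card_fin])
    refine ⟨h5, Z y, hmem Z hZ x y hy, hZ0 y, fun w hw ↦ ?_⟩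
    rw [← h6] at hw
    induction hw using Submodule.span_induction with
    | mem w hw =>
      obtain ⟨i, rfl⟩ := hw
      fin_cases i
      exacts [hZV a b y, hZZ y]
    | zero => simp
    | add u v _ _ hu hv => rw [map_add, hu, hv, add_zero]
    | smul r v _ hv => rw [map_smul, hv, smul_zero]
  -- The coefficients `a, b` are adapted to `x` alone: independence is needed only there, while the
  -- orthogonality relations hold at every point for all `a, b`.
  · obtain ⟨a, b, hli⟩ := (hlight x).2
    have hV : IsKilling h (a • X + b • Y) := by simpa using H.killing a b 0
    exact exists_conformal_chart_of_killing hV H.killing_center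
      (by simpa using H.bracket_center a b 0) hZZ (hZV a b) hli
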